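/- Let $\mathbb{B}^2=\{z\in\mathbb{C}^2 : |z|^2=|z_1|^2+|z_2|^2<1\}$, and let $\mathrm{SU}((2,1),\mathbb{C})=\{A\in \mathrm{SL}(3,\mathbb{C}) : A^*HA=H\}$, $H=\mathrm{diag}(1,1,-1)$, act on $\mathbb{B}^2$ by fractional linear transformations $\gamma z=(Az+B)/(Cz+D)$. Let $\Gamma\subset\mathrm{SU}((2,1),\mathbb{C})$ be a discrete, torsion-free subgroup such that $X_\Gamma=\Gamma\backslash\mathbb{B}^2$ is compact, and let $\mathcal{F}_\Gamma\subset\mathbb{B}^2$ be a fundamental domain for $\Gamma$. Let $$\mu^{\mathrm{vol}}_{\mathrm{hyp}}(z)=\Big(\frac{i}{2}\Big)^2\frac{dz_1\wedge d\bar z_1\wedge dz_2\wedge d\bar z_2}{(1-|z|^2)^3}$$ be the hyperbolic volume form. For $k\ge 1$ let $\Lambda=\Omega^2_{X_\Gamma}$ and let $H^0(X_\Gamma,\Lambda^{\otimes k})$ be the space of $\Gamma$-invariant holomorphic forms $\omega=f\,(dz_1\wedge dz_2)^{\otimes k}$ on $\mathbb{B}^2$, with the point-wise norm $|\omega(z)|^2_{\mathrm{hyp}}=(1-|z|^2)^{3k}|f(z)|^2$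 and the inner product $\langle \omega,\eta\rangle_{\mathrm{hyp}}=\int_{\mathcal{F}_\Gamma}(1-|z|^2)^{3k}f(z)\overline{g(z)}\,\mu^{\mathrm{vol}}_{\mathrm{hyp}}(z)$ for $\eta=g\,(dz_1\wedge dz_2)^{\otimes k}$. This space has a finite orthonormal basis. For an orthonormal basis $\omega_j=f_j\,(dz_1\wedge dz_2)^{\otimes k}$, $1\le j\le d_k$, let $$\big|\mathcal{B}^k_{\Lambda}(z,z)\big|_{\mathrm{hyp}}=(1-|z|^2)^{3k}\sum_{j=1}^{d_k}|f_j(z)|^2$$ be the norm of the Bergman kernel on the diagonal, let $\mu_{\mathrm{ber}}(z)=-\frac{i}{2\pi}\partial\bar\partial\log|\mathcal{B}^k_{\Lambda}(z,z)|_{\mathrm{hyp}}$ be the Bergman metric associated to $\Lambda^{\otimes k}$, and let $\mu^{\mathrm{vol}}_{\mathrm{ber}}=\frac{1}{2!}\,\mu_{\mathrm{ber}}\wedge\mu_{\mathrm{ber}}$ (both depend on $k$). Then, for every choice of orthonormal bases and for each $z\in\mathcal{F}_\Gamma$: for all sufficiently large $k$ (depending on $z$) the Bergman kernel does not vanish at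 $(z,z)$, so that $\mu_{\mathrm{ber}}$ is defined near $z$; the following limit exists; and $$\lim_{k\to\infty}\frac{1}{k^4\log k}\left|\frac{\mu^{\mathrm{vol}}_{\mathrm{ber}}(z)}{\mu^{\mathrm{vol}}_{\mathrm{hyp}}(z)}\right|\le 6048 .$$ -/

import Mathlib

open MeasureTheory Filter Topology Matrix

noncomputable section

namespace Picard

/-- The complex Euclidean plane `ℂ²`. -/
abbrev E : Type := EuclideanSpace ℂ (Fin 2)

/-- The unit ball `𝔹² = {z ∈ ℂ² | |z₁|² + |z₂|² < 1}`. -/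
abbrev Ball2 : Type := ↥(Metric.ball (0 : E) 1)

/-- The Hermitian matrix `H = diag(1, 1, -1)` of signature `(2, 1)`. -/
def H : Matrix (Fin 3) (Fin 3) ℂ := Matrix.diagonal ![1, 1, -1]

lemma unitary_mul {A B : Matrix (Fin 3) (Fin 3) ℂ} (hA : Aᴴ * H * A = H) (hB : Bᴴ * H * B = H) :
    (A * B)ᴴ * H * (A * B) = H := by
  calc (A * B)ᴴ * H * (A * B) = Bᴴ * (Aᴴ * H * A) * B := by
        rw [conjTranspose_mul]; simp only [Matrix.mul_assoc]
    _ = H := by rw [hA, hB]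

lemma unitary_inv {A B : Matrix (Fin 3) (Fin 3) ℂ} (hA : Aᴴ * H * A = H) (h : A * B = 1) :
    Bᴴ * H * B = H := by
  have h' : Bᴴ * Aᴴ = 1 := by rw [← conjTranspose_mul, h, conjTranspose_one]
  calc Bᴴ * H * B = Bᴴ * (Aᴴ * H * A) * B := by rw [hA]
    _ = (Bᴴ * Aᴴ) * H * (A * B) := by simp only [Matrix.mul_assoc]
    _ = H := by rw [h, h', Matrix.one_mul, Matrix.mul_one]

/-- `SU((2,1), ℂ) = {A ∈ SL(3, ℂ) | A* H A = H}`. -/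
def SU21 : Subgroup (Matrix.SpecialLinearGroup (Fin 3) ℂ) where
  carrier := {A | (A : Matrix (Fin 3) (Fin 3) ℂ)ᴴ * H * (A : Matrix (Fin 3) (Fin 3) ℂ) = H}
  one_mem' := by simp
  mul_mem' := fun hA hB => unitary_mul hA hB
  inv_mem' := fun {A} hA => unitary_inv hA (congrArg Subtype.val (mul_inv_cancel A))

/-- The matrix of an element of `SU((2,1), ℂ)`. -/
def mat (g : SU21) : Matrix (Fin 3) (Fin 3) ℂ := (g : Matrix.SpecialLinearGroup (Fin 3) ℂ)

/-- The lift `(z₁, z₂, 1)` of a point of `ℂ²` to `ℂ³`. -/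
def lift (z : E) : Fin 3 → ℂ := ![z 0, z 1, 1]

/-- The fractional linear transformation `z ↦ (Az + B)/(Cz + D)` of a `3 × 3` matrix in block
form `(A, B; C, D)`: apply the matrix to the lift of `z` and divide by the last coordinate. -/
def moebius (g : Matrix (Fin 3) (Fin 3) ℂ) (z : E) : E :=
  !₂[(g *ᵥ lift z) 0 / (g *ᵥ lift z) 2, (g *ᵥ lift z) 1 / (g *ᵥ lift z) 2]

lemma mem_ball_iff (z : E) :
    z ∈ Metric.ball (0 : E) 1 ↔ ‖z 0‖ ^ 2 + ‖z 1‖ ^ 2 < 1 := by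
  rw [mem_ball_zero_iff, EuclideanSpace.norm_eq, Real.sqrt_lt' one_pos]
  simp

lemma hermForm_eq (v : Fin 3 → ℂ) :
    star v ⬝ᵥ (H *ᵥ v) = ((‖v 0‖ ^ 2 + ‖v 1‖ ^ 2 - ‖v 2‖ ^ 2 : ℝ) : ℂ) := by
  have h (x : ℂ) : (starRingEnd ℂ) x * x = ((‖x‖ ^ 2 : ℝ) : ℂ) := by
    rw [mul_comm, Complex.mul_conj, Complex.normSq_eq_norm_sq]
  simp only [dotProduct, H, mulVec_diagonal, Fin.sum_univ_three, Pi.star_apply,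
    Complex.ofReal_sub, Complex.ofReal_add, ← h]
  simp
  ring

lemma hermForm_mulVec (g : SU21) (v : Fin 3 → ℂ) :
    star (mat g *ᵥ v) ⬝ᵥ (H *ᵥ (mat g *ᵥ v)) = star v ⬝ᵥ (H *ᵥ v) := by
  have hg : ((mat g))ᴴ * H * (mat g) = H := g.2
  rw [star_mulVec, ← dotProduct_mulVec, mulVec_mulVec, mulVec_mulVec, hg]

lemma norm_mulVec_lift (g : SU21) (z : E) :
    ‖(mat g *ᵥ lift z) 0‖ ^ 2 + ‖(mat g *ᵥ lift z) 1‖ ^ 2 - ‖(mat g *ᵥ lift z) 2‖ ^ 2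
      = ‖z 0‖ ^ 2 + ‖z 1‖ ^ 2 - 1 := by
  have h := hermForm_mulVec g (lift z)
  rw [hermForm_eq, hermForm_eq] at h
  have h2 := Complex.ofReal_injective h
  simpa [lift] using h2

lemma denom_ne_zero (g : SU21) (z : Ball2) : (mat g *ᵥ lift z.1) 2 ≠ 0 := by
  intro h0
  have h := norm_mulVec_lift g z.1
  have hz := (mem_ball_iff z.1).1 z.2
  rw [h0] at h
  have h1 := sq_nonneg ‖(mat g *ᵥ lift z.1) 0‖
  have h2 := sq_nonneg ‖(mat g *ᵥ lift z.1) 1‖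
  simp only [norm_zero] at h
  linarith

lemma moebius_mem_ball (g : SU21) (z : Ball2) :
    moebius (mat g) z.1 ∈ Metric.ball (0 : E) 1 := by
  rw [mem_ball_iff]
  have h := norm_mulVec_lift g z.1
  have hz := (mem_ball_iff z.1).1 z.2
  have hpos : 0 < ‖(mat g *ᵥ lift z.1) 2‖ ^ 2 :=
    pow_pos (norm_pos_iff.2 (denom_ne_zero g z)) 2
  simp only [moebius, PiLp.toLp_apply, Matrix.cons_val_zero, Matrix.cons_val_one, norm_div, div_pow]
  rw [← add_div, div_lt_one hpos]
  linarith

lemma lift_moebius (g : SU21) (z : Ball2) :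
    lift (moebius (mat g) z.1) = ((mat g *ᵥ lift z.1) 2)⁻¹ • (mat g *ᵥ lift z.1) := by
  have h := denom_ne_zero g z
  ext i
  fin_cases i
  · simp [lift, moebius, div_eq_inv_mul]
  · simp [lift, moebius, div_eq_inv_mul]
  · simpa [lift, moebius] using (inv_mul_cancel₀ h).symm

lemma mat_mul (g h : SU21) : mat (g * h) = mat g * mat h := by
  simp [mat]

/-- The action of `SU((2,1), ℂ)` on the ball by fractional linear transformations. -/
instance : MulAction SU21 Ball2 where
  smul g z := ⟨moebius (mat g) z.1, moebius_mem_ball g z⟩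
  one_smul z := by
    apply Subtype.ext
    change moebius (mat 1) z.1 = z.1
    ext i
    fin_cases i <;> simp [moebius, lift, mat]
  mul_smul g h z := by
    apply Subtype.ext
    change moebius ((mat (g * h))) z.1 = moebius (mat g) (moebius (mat h) z.1)
    have h1 : (mat (g * h)) *ᵥ lift z.1 = (mat g) *ᵥ (mat h *ᵥ lift z.1) := by
      rw [mulVec_mulVec, mat_mul]
    have h2 := inv_ne_zero (denom_ne_zero h z)
    have h3 : (mat g) *ᵥ lift (moebius (mat h) z.1)
        = ((mat h *ᵥ lift z.1) 2)⁻¹ • ((mat (g * h)) *ᵥ lift z.1) := by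
      rw [lift_moebius, mulVec_smul, h1]
    rw [moebius, moebius.eq_1 (mat g), h3]
    simp only [Pi.smul_apply, smul_eq_mul, mul_div_mul_left _ _ h2]

/-- The quotient `X_Γ = Γ \ 𝔹²`, with the quotient topology. -/
abbrev PicardSurface (Γ : Subgroup SU21) : Type := MulAction.orbitRel.Quotient Γ Ball2

/-- The measure on `𝔹²` given by the hyperbolic volume form
`(i/2)² dz₁ ∧ dz̄₁ ∧ dz₂ ∧ dz̄₂ / (1 - |z|²)³`; here `(i/2)² dz₁ ∧ dz̄₁ ∧ dz₂ ∧ dz̄₂` is Lebesgue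
measure on `ℂ²`. -/
def hypMeasure : Measure Ball2 :=
  (Measure.comap (Subtype.val : Ball2 → E) volume).withDensity
    (fun z => ENNReal.ofReal (((1 - ‖z.1‖ ^ 2) ^ 3)⁻¹))

/-- A function on the ball, extended by zero to `ℂ²`. -/
def extendZero (f : Ball2 → ℂ) : E → ℂ := Function.extend Subtype.val f 0

lemma extendZero_apply (f : Ball2 → ℂ) {x : E} (hx : x ∈ Metric.ball (0 : E) 1) :
    extendZero f x = f ⟨x, hx⟩ :=
  Subtype.val_injective.extend_apply f 0 (⟨x, hx⟩ : Ball2)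

/-- A function on the (open) ball is holomorphic. -/
def IsHolomorphic (f : Ball2 → ℂ) : Prop :=
  DifferentiableOn ℂ (extendZero f) (Metric.ball (0 : E) 1)

/-- The complex Jacobian determinant of the action of `γ` on the ball, that is, the function `j`
with `γ^*(dz₁ ∧ dz₂) = j dz₁ ∧ dz₂`. -/
def jacobian (γ : SU21) (z : Ball2) : ℂ := (fderiv ℂ (moebius (mat γ)) z.1).det

/-- `H⁰(X_Γ, Λ^{⊗k})` for `Λ = Ω²_{X_Γ}`: holomorphic sections of `Λ^{⊗k}` are the holomorphic
sections `f (dz₁ ∧ dz₂)^{⊗k}` over the ball which are invariant under pull-back by every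
`γ ∈ Γ`. The section is represented by its coefficient `f`. -/
def H0 (Γ : Subgroup SU21) (k : ℕ) : Submodule ℂ (Ball2 → ℂ) where
  carrier := {f | IsHolomorphic f ∧ ∀ γ ∈ Γ, ∀ z : Ball2, f (γ • z) * jacobian γ z ^ k = f z}
  zero_mem' := by
    refine ⟨?_, fun γ _ z => by simp⟩
    refine (differentiableOn_const (0 : ℂ)).congr (fun x hx => ?_)
    rw [extendZero_apply _ hx]; rfl
  add_mem' := by
    rintro f g ⟨hf, hf'⟩ ⟨hg, hg'⟩
    refine ⟨?_, fun γ hγ z => ?_⟩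
    · refine (DifferentiableOn.add hf hg).congr (fun x hx => ?_)
      simp only [Pi.add_apply, extendZero_apply _ hx]
    · rw [Pi.add_apply, Pi.add_apply, add_mul, hf' γ hγ z, hg' γ hγ z]
  smul_mem' := by
    rintro c f ⟨hf, hf'⟩
    refine ⟨?_, fun γ hγ z => ?_⟩
    · refine (DifferentiableOn.const_smul hf c).congr (fun x hx => ?_)
      simp only [Pi.smul_apply, extendZero_apply _ hx]
    · rw [Pi.smul_apply, Pi.smul_apply, smul_mul_assoc, hf' γ hγ z]

/-- The `L²` inner product on `H⁰(X_Γ, Λ^{⊗k})` induced by the hyperbolic metric, for which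
`|dz₁ ∧ dz₂|² = (1 - |z|²)³`, as an integral over a fundamental domain `F`. -/
def innerHyp (F : Set Ball2) (k : ℕ) (f g : Ball2 → ℂ) : ℂ :=
  ∫ z in F, (((1 - ‖z.1‖ ^ 2) ^ (3 * k) : ℝ) : ℂ) * f z * starRingEnd ℂ (g z) ∂hypMeasure

/-- `ω₁, …, ω_d` is an orthonormal basis of `H⁰(X_Γ, Λ^{⊗k})`. -/
def IsOrthonormalBasis (Γ : Subgroup SU21) (F : Set Ball2) (k : ℕ) {d : ℕ}
    (ω : Fin d → H0 Γ k) : Prop :=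
  (∀ i j, innerHyp F k (ω i) (ω j) = if i = j then 1 else 0) ∧
    Submodule.span ℂ (Set.range ω) = ⊤

/-- The Bergman kernel `∑ⱼ ωⱼ(z) conj(ωⱼ(w))` of a basis of `H⁰(X_Γ, Λ^{⊗k})`, in the frames
`(dz₁ ∧ dz₂)^{⊗k}` and `conj (dw₁ ∧ dw₂)^{⊗k}`. -/
def bergmanKernel {Γ : Subgroup SU21} {k d : ℕ} (ω : Fin d → H0 Γ k) (z w : Ball2) : ℂ :=
  ∑ j, (ω j : Ball2 → ℂ) z * starRingEnd ℂ ((ω j : Ball2 → ℂ) w)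

/-- The hyperbolic norm `|B(z, z)|_hyp = (1 - |z|²)^{3k} |B(z, z)|` of the Bergman kernel on the
diagonal. -/
def bergmanNorm {Γ : Subgroup SU21} {k d : ℕ} (ω : Fin d → H0 Γ k) (z : Ball2) : ℝ :=
  (1 - ‖z.1‖ ^ 2) ^ (3 * k) * ‖bergmanKernel ω z z‖

/-- The `j`-th standard basis vector of `ℂ²`. -/
def e (j : Fin 2) : E := EuclideanSpace.single j 1

/-- The Wirtinger derivative `∂φ/∂z_j = ½ (∂φ/∂x_j - i ∂φ/∂y_j)`. -/
def dZ (j : Fin 2) (φ : E → ℂ) (z : E) : ℂ :=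
  (1 / 2) * (fderiv ℝ φ z (e j) - Complex.I * fderiv ℝ φ z (Complex.I • e j))

/-- The Wirtinger derivative `∂φ/∂z̄_j = ½ (∂φ/∂x_j + i ∂φ/∂y_j)`. -/
def dZbar (j : Fin 2) (φ : E → ℂ) (z : E) : ℂ :=
  (1 / 2) * (fderiv ℝ φ z (e j) + Complex.I * fderiv ℝ φ z (Complex.I • e j))

/-- The form `∂∂̄φ = ∑_{j,l} ∂²φ/∂z_j∂z̄_l dz_j ∧ dz̄_l` at the point `z`, as an alternating function
of two tangent vectors. -/
def ddbar (φ : E → ℂ) (z : E) (u v : E) : ℂ :=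
  ∑ j : Fin 2, ∑ l : Fin 2,
    dZ j (dZbar l φ) z * (u j * starRingEnd ℂ (v l) - v j * starRingEnd ℂ (u l))

/-- For a `2`-form `α` on `ℂ² = ℝ⁴`, the `4`-form `(1/2!) α ∧ α`. -/
def halfWedgeSq (α : E → E → ℂ) (v : Fin 4 → E) : ℂ :=
  α (v 0) (v 1) * α (v 2) (v 3) - α (v 0) (v 2) * α (v 1) (v 3) + α (v 0) (v 3) * α (v 1) (v 2)

/-- The Bergman metric `-(i/2π) ∂∂̄ log |B(z, z)|_hyp` at the point `z`, as a `(1,1)`-form. -/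
def bergmanMetric {Γ : Subgroup SU21} {k d : ℕ} (ω : Fin d → H0 Γ k) (z : Ball2) (u v : E) : ℂ :=
  -(Complex.I / (2 * Real.pi)) *
    ddbar (extendZero fun x => (Real.log (bergmanNorm ω x) : ℂ)) z.1 u v

/-- The volume form of the Bergman metric at `z`. -/
def bergmanVol {Γ : Subgroup SU21} {k d : ℕ} (ω : Fin d → H0 Γ k) (z : Ball2) :
    (Fin 4 → E) → ℂ :=
  halfWedgeSq (bergmanMetric ω z)

/-- The hyperbolic volume form `(i/2)² dz₁ ∧ dz̄₁ ∧ dz₂ ∧ dz̄₂ / (1 - |z|²)³` at `z`; the wedge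
product of the four `1`-forms is the determinant of their values. -/
def hypVol (z : Ball2) (v : Fin 4 → E) : ℂ :=
  (Complex.I / 2) ^ 2 *
    (Matrix.of fun a b : Fin 4 =>
      ![v b 0, starRingEnd ℂ (v b 0), v b 1, starRingEnd ℂ (v b 1)] a).det /
    (1 - ‖z.1‖ ^ 2 : ℝ) ^ 3

/-- The real frame `e₁, i e₁, e₂, i e₂` of `ℂ²`. -/
def frame : Fin 4 → E := ![e 0, Complex.I • e 0, e 1, Complex.I • e 1]

/-- The function `μ^vol_ber / μ^vol_hyp`: as the space of alternating `4`-forms on `ℝ⁴` is a line,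
the quotient of two `4`-forms is the quotient of their values on a frame. -/
def volRatio {Γ : Subgroup SU21} {k d : ℕ} (ω : Fin d → H0 Γ k) (z : Ball2) : ℂ :=
  bergmanVol ω z frame / hypVol z frame

end Picard

end

/-! The volume ratio is `O(k⁴)` at each fixed `z`, so after division by `k⁴ log k` the limit exists
and equals `0`; the value 6048 plays no role beyond being nonnegative.

The growth bound rests on two-sided control of the Bergman kernel. Write `z = g • 0`, which is
possible because the action on the ball is transitive, and let `j` be the Jacobian. Unfolding the
inner product of a section with the Poincaré series `∑_γ j(g⁻¹γ, ·)^k`, followed by the mean value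
property for a circle-invariant weight, shows that this series reproduces values at `z` up to the
factor `W_k = ∫ (1 - |w|²)^{3k-3}`. Expanding it in an orthonormal basis gives
`bergmanNorm_mul_weightIntegral`: the norm of the kernel at `z`, times `W_k`, equals `∑_γ j(g⁻¹γg,
0)^k`.

Since `|j(h, 0)|² = (1 - |h • 0|²)³ ≤ 1`, the terms are dominated, for all `k ≥ 2` at once, by a
multiple of `|j(γ, z)|²`, and that series converges normally near `z` because the translates of a
compact ball overlap boundedly often. Hence the normalized kernel is bounded near `z` independently
of `k` (`exists_bergmanNorm_mul_le`). Torsion-freeness makes every term with `γ ≠ 1` strictly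
smaller than 1 in absolute value, so by dominated convergence the normalized kernel tends to 1 at
`z` (`eventually_half_le_bergmanNorm_mul`); in particular it is eventually nonzero.

On discs of radius comparable to `1/k` the weight `(1 - |z|²)^{3k}` loses at most a factor 2, so the
two bounds and Cauchy's estimate give `∑ |∂f_i|² ≤ C k² ∑ |f_i|²` at `z`
(`exists_sum_norm_fderiv_sq_le`). Cauchy–Schwarz then bounds `∂∂̄ log ∑ |f_i|²` by `O(k²)`, the
weight contributes only `O(k)`, and the volume form is quadratic in these derivatives.

Finiteness of the orthonormal basis comes from integrating `∑ |v_i|² ≤ C`, valid for every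
orthonormal family, over a fundamental domain of finite volume. -/

noncomputable section

namespace Picard

/-! ### Cauchy estimates and holomorphy of derivatives and series in several variables. -/

section ComplexAnalysis

variable {V W : Type*} [NormedAddCommGroup V] [NormedSpace ℂ V]
  [NormedAddCommGroup W] [NormedSpace ℂ W]

lemma hasDerivAt_line {f : V → W} {z v : V} {t : ℂ} (h : DifferentiableAt ℂ f (z + t • v)) :
    HasDerivAt (fun s : ℂ => f (z + s • v)) (fderiv ℂ f (z + t • v) v) t := by
  have h1 : HasDerivAt (fun s : ℂ => z + s • v) v t := by
    simpa using ((hasDerivAt_id t).smul_const v).const_add z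
  exact h.hasFDerivAt.comp_hasDerivAt t h1

/-- The Cauchy estimate for the derivative in a direction. -/
lemma norm_fderiv_apply_le {f : V → W} {z v : V} {r C : ℝ} (hr : 0 < r)
    (hf : ∀ t : ℂ, ‖t‖ ≤ r → DifferentiableAt ℂ f (z + t • v))
    (hC : ∀ t : ℂ, ‖t‖ ≤ r → ‖f (z + t • v)‖ ≤ C) :
    ‖fderiv ℂ f z v‖ ≤ C / r := by
  have h0 : HasDerivAt (fun s : ℂ => f (z + s • v)) (fderiv ℂ f z v) 0 := by
    simpa using hasDerivAt_line (hf 0 (by simpa using hr.le))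
  rw [← h0.deriv]
  refine Complex.norm_deriv_le_of_forall_mem_sphere_norm_le hr ?_ ?_
  · refine DifferentiableOn.diffContOnCl_ball (U := Metric.closedBall 0 r) (fun t ht => ?_)
      le_rfl
    exact (hasDerivAt_line (hf t (by simpa using ht))).differentiableAt.differentiableWithinAt
  · intro t ht
    exact hC t (by simpa using (mem_sphere_zero_iff_norm.1 ht).le)

/-- The Cauchy estimate for the operator norm of the derivative. -/
lemma norm_fderiv_le {f : V → W} {z : V} {r C : ℝ} (hr : 0 < r)
    (hf : ∀ x ∈ Metric.closedBall z r, DifferentiableAt ℂ f x)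
    (hC : ∀ x ∈ Metric.closedBall z r, ‖f x‖ ≤ C) :
    ‖fderiv ℂ f z‖ ≤ C / r := by
  have hC0 : 0 ≤ C := (norm_nonneg _).trans (hC z (Metric.mem_closedBall_self hr.le))
  refine ContinuousLinearMap.opNorm_le_bound _ (by positivity) fun v => ?_
  rcases eq_or_ne v 0 with rfl | hv
  · simp
  have hv' : 0 < ‖v‖ := norm_pos_iff.2 hv
  have hmem : ∀ t : ℂ, ‖t‖ ≤ r / ‖v‖ → z + t • v ∈ Metric.closedBall z r := fun t ht => by
    rw [mem_closedBall_iff_norm, add_sub_cancel_left, norm_smul]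
    exact (le_div_iff₀ hv').1 ht
  refine (norm_fderiv_apply_le (r := r / ‖v‖) (by positivity) (fun t ht => hf _ (hmem t ht))
    (fun t ht => hC _ (hmem t ht))).trans_eq ?_
  field_simp

/-- The directional derivatives of a holomorphic function are holomorphic. -/
lemma differentiableOn_fderiv_apply [FiniteDimensional ℂ V] [MeasurableSpace V] [BorelSpace V]
    [FiniteDimensional ℂ W] {f : V → W} {U : Set V} (hU : IsOpen U) (hf : DifferentiableOn ℂ f U)
    (v : V) : DifferentiableOn ℂ (fun w => fderiv ℂ f w v) U := by
  intro z hz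
  have : ProperSpace V := FiniteDimensional.proper ℂ V
  have : CompleteSpace W := FiniteDimensional.complete ℂ W
  have : FiniteDimensional ℂ (V →L[ℂ] W) := inferInstance
  have : ProperSpace (V →L[ℂ] W) := FiniteDimensional.proper ℂ _
  borelize (V →L[ℂ] W)
  obtain ⟨R, hR, hRU⟩ := Metric.nhds_basis_closedBall.mem_iff.1 (hU.mem_nhds hz)
  have hd : ∀ x ∈ Metric.closedBall z R, DifferentiableAt ℂ f x := fun x hx =>
    hf.differentiableAt (hU.mem_nhds (hRU hx))
  obtain ⟨C, hC⟩ := (isCompact_closedBall z R).exists_bound_of_continuousOn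
    (hf.continuousOn.mono hRU)
  -- Three displacements must fit into radius `R`: from `z` to `x`, along the circle in direction
  -- `v`, and the ball used for the Cauchy estimate.
  set ε := R / 3 with hε
  have hε0 : 0 < ε := by positivity
  set r := ε / (‖v‖ + 1) with hrdef
  have hr : 0 < r := by positivity
  have hrv : r * ‖v‖ ≤ ε := by
    rw [hrdef, div_mul_eq_mul_div, div_le_iff₀ (by positivity)]
    nlinarith [norm_nonneg v]
  have hmem : ∀ x ∈ Metric.ball z ε, ∀ t : ℂ, ‖t‖ ≤ r → ∀ y ∈ Metric.closedBall (x + t • v) ε,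
      y ∈ Metric.closedBall z R := by
    intro x hx t ht y hy
    rw [mem_closedBall_iff_norm] at hy ⊢
    rw [mem_ball_iff_norm] at hx
    have h1 : ‖t • v‖ ≤ ε := by
      rw [norm_smul]; exact (mul_le_mul_of_nonneg_right ht (norm_nonneg v)).trans hrv
    calc ‖y - z‖ = ‖(y - (x + t • v)) + (x - z) + t • v‖ := by congr 1; abel
      _ ≤ ‖y - (x + t • v)‖ + ‖x - z‖ + ‖t • v‖ := norm_add₃_le
      _ ≤ R := by rw [hε] at *; linarith
  have hself : ∀ x ∈ Metric.ball z ε, ∀ t : ℂ, ‖t‖ ≤ r → x + t • v ∈ Metric.closedBall z R :=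
    fun x hx t ht => hmem x hx t ht _ (Metric.mem_closedBall_self hε0.le)
  have hbound : ∀ x ∈ Metric.ball z ε, ∀ t : ℂ, ‖t‖ ≤ r → ‖fderiv ℂ f (x + t • v)‖ ≤ C / ε :=
    fun x hx t ht => norm_fderiv_le hε0 (fun y hy => hd y (hmem x hx t ht y hy))
      (fun y hy => hC y (hmem x hx t ht y hy))
  have hcm : ∀ θ : ℝ, ‖circleMap 0 r θ‖ ≤ r := fun θ => by simp [abs_of_pos hr]
  -- Cauchy's formula on the complex line through `x` expresses the derivative through values of `f`
  -- alone. The integral can then be differentiated in `x` under the integral sign, with a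
  -- dominating constant from the Cauchy estimate.
  have hformula : ∀ x ∈ Metric.ball z ε, fderiv ℂ f x v = (2 * Real.pi * Complex.I : ℂ)⁻¹ •
      ∫ θ in (0 : ℝ)..2 * Real.pi, (deriv (circleMap 0 r) θ * ((circleMap 0 r θ - 0) ^ 2)⁻¹) •
        f (x + circleMap 0 r θ • v) := by
    intro x hx
    have h0 : HasDerivAt (fun s : ℂ => f (x + s • v)) (fderiv ℂ f x v) 0 := by
      simpa using hasDerivAt_line (f := f) (z := x) (v := v) (t := 0)
        (hd _ (hself x hx 0 (by simpa using hr.le)))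
    have h1 : DiffContOnCl ℂ (fun s : ℂ => f (x + s • v)) (Metric.ball 0 r) := by
      refine DifferentiableOn.diffContOnCl_ball (U := Metric.closedBall 0 r) (fun t ht => ?_)
        le_rfl
      exact (hasDerivAt_line (hd _ (hself x hx t (by simpa using ht)))).differentiableAt.differentiableWithinAt
    have h2 := h1.deriv_eq_smul_circleIntegral hr
    simp only [circleIntegral, smul_smul, one_div] at h2
    rw [h2, h0.deriv, smul_smul, inv_mul_cancel₀ Complex.two_pi_I_ne_zero, one_smul]
  have hcont : ∀ x ∈ Metric.ball z ε, Continuous fun θ : ℝ => f (x + circleMap 0 r θ • v) := by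
    intro x hx
    refine (hf.continuousOn.mono hRU).comp_continuous (by fun_prop) fun θ => ?_
    exact hself x hx _ (hcm θ)
  have hk : Continuous fun θ : ℝ => deriv (circleMap 0 r) θ * ((circleMap 0 r θ - 0) ^ 2)⁻¹ := by
    simp only [deriv_circleMap, sub_zero]
    refine Continuous.mul (by fun_prop) (Continuous.inv₀ (by fun_prop) fun θ => ?_)
    exact pow_ne_zero _ (circleMap_ne_center hr.ne')
  have hkb : ∀ θ : ℝ, ‖deriv (circleMap 0 r) θ * ((circleMap 0 r θ - 0) ^ 2)⁻¹‖ = r⁻¹ := by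
    intro θ
    simp [deriv_circleMap, abs_of_pos hr]
    field_simp
  have hpoint : HasFDerivAt (fun x => ∫ θ in (0 : ℝ)..2 * Real.pi,
      (deriv (circleMap 0 r) θ * ((circleMap 0 r θ - 0) ^ 2)⁻¹) • f (x + circleMap 0 r θ • v))
      (∫ θ in (0 : ℝ)..2 * Real.pi,
      (deriv (circleMap 0 r) θ * ((circleMap 0 r θ - 0) ^ 2)⁻¹) •
        fderiv ℂ f (z + circleMap 0 r θ • v)) z := by
    refine (intervalIntegral.hasFDerivAt_integral_of_dominated_of_fderiv_le
      (bound := fun _ => r⁻¹ * (C / ε)) (F' := fun x θ =>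
        (deriv (circleMap 0 r) θ * ((circleMap 0 r θ - 0) ^ 2)⁻¹) •
        fderiv ℂ f (x + circleMap 0 r θ • v)) (Metric.ball_mem_nhds z hε0) ?_ ?_ ?_ ?_ ?_ ?_)
    · filter_upwards [Metric.ball_mem_nhds z hε0] with x hx
      exact (hk.smul (hcont x hx)).aestronglyMeasurable
    · exact (hk.smul (hcont z (Metric.mem_ball_self hε0))).intervalIntegrable _ _
    · refine (Measurable.aestronglyMeasurable ?_)
      exact hk.measurable.smul ((measurable_fderiv ℂ f).comp
        (Continuous.measurable (by fun_prop)))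
    · refine Eventually.of_forall fun θ _ x hx => ?_
      rw [norm_smul, hkb]
      exact mul_le_mul_of_nonneg_left (hbound x hx _ (hcm θ)) (by positivity)
    · simp
    · refine Eventually.of_forall fun θ _ x hx => ?_
      have h2 := (hd _ (hself x hx _ (hcm θ))).hasFDerivAt
      exact ((hasFDerivAt_comp_add_right _).2 h2).const_smul _
  refine DifferentiableAt.differentiableWithinAt ?_
  refine (hpoint.differentiableAt.const_smul ((2 * Real.pi * Complex.I : ℂ)⁻¹)).congr_of_eventuallyEq ?_
  filter_upwards [Metric.ball_mem_nhds z hε0] with x hx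
  exact hformula x hx

/-- A normally convergent series of holomorphic functions is holomorphic. -/
lemma differentiableAt_tsum_of_summable_norm [CompleteSpace W] {ι : Type*} {f : ι → V → W}
    {u : ι → ℝ} {z : V} {r : ℝ} (hr : 0 < r) (hu : Summable u)
    (hf : ∀ i, ∀ x ∈ Metric.ball z r, DifferentiableAt ℂ (f i) x)
    (hfu : ∀ i, ∀ x ∈ Metric.ball z r, ‖f i x‖ ≤ u i) :
    DifferentiableAt ℂ (fun x => ∑' i, f i x) z := by
  have hmem : ∀ x ∈ Metric.ball z (r / 2), ∀ y ∈ Metric.closedBall x (r / 3),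
      y ∈ Metric.ball z r := by
    intro x hx y hy
    rw [Metric.mem_ball] at *
    rw [Metric.mem_closedBall] at hy
    linarith [dist_triangle y x z]
  have hz : z ∈ Metric.ball z (r / 2) := Metric.mem_ball_self (by positivity)
  have hz' : z ∈ Metric.ball z r := Metric.mem_ball_self (by positivity)
  let _ : NormedSpace ℝ V := NormedSpace.restrictScalars ℝ ℂ V
  refine (hasFDerivAt_tsum_of_isPreconnected (u := fun i => u i / (r / 3))
    (f' := fun i x => fderiv ℂ (f i) x) (hu.div_const _) Metric.isOpen_ball
    (convex_ball z (r / 2)).isPreconnected (fun i x hx => ?_) (fun i x hx => ?_) hz ?_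
    hz).differentiableAt
  · exact (hf i x (hmem x hx x (Metric.mem_closedBall_self (by positivity)))).hasFDerivAt
  · exact norm_fderiv_le (by positivity) (fun y hy => hf i y (hmem x hx y hy))
      (fun y hy => hfu i y (hmem x hx y hy))
  · exact Summable.of_norm_bounded hu fun i => hfu i z hz'

end ComplexAnalysis

/-! ### Mean value properties for holomorphic functions on balls in `ℂ²`. -/

section MeanValue

lemma measurePreserving_smul_of_norm_eq_one {c : ℂ} (hc : ‖c‖ = 1) :
    MeasurePreserving (fun u : E => c • u) := by
  have hc0 : c ≠ 0 := by
    rintro rfl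
    simp at hc
  let L : E ≃ₗᵢ[ℝ] E :=
    { (LinearEquiv.smulOfNeZero ℂ E c hc0).restrictScalars ℝ with
      norm_map' := fun x => by
        change ‖c • x‖ = ‖x‖
        rw [norm_smul, hc, one_mul] }
  exact L.measurePreserving

/-- The mean value property with respect to a circle-invariant weight on a ball. -/
lemma setIntegral_weight_mul {h : E → ℂ} {ρ : E → ℝ} {R : ℝ}
    (hh : DifferentiableOn ℂ h (Metric.ball 0 R)) (hρ : ContinuousOn ρ (Metric.ball 0 R))
    (hinv : ∀ c : ℂ, ‖c‖ = 1 → ∀ u, ρ (c • u) = ρ u)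
    (hint : IntegrableOn (fun u => (ρ u : ℂ) * h u) (Metric.ball 0 R)) :
    ∫ u in Metric.ball (0 : E) R, (ρ u : ℂ) * h u =
      h 0 * ∫ u in Metric.ball (0 : E) R, (ρ u : ℂ) := by
  set B := Metric.ball (0 : E) R with hB
  set I := ∫ u in B, (ρ u : ℂ) * h u with hI
  have hcm : ∀ θ : ℝ, ‖circleMap 0 1 θ‖ = 1 := fun θ => by simp
  have hmem : ∀ c : ℂ, ‖c‖ ≤ 1 → ∀ u ∈ B, c • u ∈ B := fun c hc u hu => by
    rw [hB, mem_ball_zero_iff] at *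
    rw [norm_smul]
    nlinarith [norm_nonneg u]
  have hpre : ∀ c : ℂ, ‖c‖ = 1 → (fun u : E => c • u) ⁻¹' B = B := fun c hc => by
    ext u
    simp [hB, norm_smul, hc]
  have hMP : ∀ c : ℂ, ‖c‖ = 1 → MeasurePreserving (fun u : E => c • u) (volume.restrict B)
      (volume.restrict B) := fun c hc => by
    have := (measurePreserving_smul_of_norm_eq_one hc).restrict_preimage
      (Metric.isOpen_ball (x := (0 : E)) (ε := R)).measurableSet
    rwa [← hB, hpre c hc] at this
  have hemb : ∀ c : ℂ, ‖c‖ = 1 → MeasurableEmbedding (fun u : E => c • u) := fun c hc =>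
    (Homeomorph.smulOfNeZero c (by rintro rfl; simp at hc)).measurableEmbedding
  -- Fubini on circle times ball: integrating over `u` first gives `I` for every `θ`, by rotation
  -- invariance, while integrating over `θ` first gives the one-variable mean value `h 0`.
  let G : ℝ → E → ℂ := fun θ u => (ρ u : ℂ) * h (circleMap 0 1 θ • u)
  have hG : ∀ θ, G θ = (fun u => (ρ u : ℂ) * h u) ∘ fun u => circleMap 0 1 θ • u := fun θ => by
    ext u
    simp [G, hinv _ (hcm θ)]
  have hGint : ∀ θ, ∫ u in B, G θ u = I := fun θ => by
    rw [hG]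
    exact (hMP _ (hcm θ)).integral_comp (hemb _ (hcm θ)) (fun u => (ρ u : ℂ) * h u)
  have hGnorm : ∀ θ, ∫ u in B, ‖G θ u‖ = ∫ u in B, ‖(ρ u : ℂ) * h u‖ := fun θ => by
    rw [hG]
    exact (hMP _ (hcm θ)).integral_comp (hemb _ (hcm θ)) (fun u => ‖(ρ u : ℂ) * h u‖)
  have hGi : ∀ θ, Integrable (G θ) (volume.restrict B) := fun θ => by
    rw [hG]
    exact ((hMP _ (hcm θ)).integrable_comp_emb (hemb _ (hcm θ))).2 hint
  have hfub : Integrable (Function.uncurry G)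
      ((volume.restrict (Set.Ioc 0 (2 * Real.pi))).prod (volume.restrict B)) := by
    have hm : AEStronglyMeasurable (Function.uncurry G)
        ((volume.restrict (Set.Ioc 0 (2 * Real.pi))).prod (volume.restrict B)) := by
      rw [Measure.prod_restrict]
      refine ContinuousOn.aestronglyMeasurable ?_
        (measurableSet_Ioc.prod Metric.isOpen_ball.measurableSet)
      refine ContinuousOn.mul ?_ ?_
      · exact Complex.continuous_ofReal.comp_continuousOn
          (hρ.comp continuousOn_snd fun p hp => hp.2)
      · exact hh.continuousOn.comp (Continuous.continuousOn (by fun_prop))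
          fun p hp => hmem _ (hcm _).le _ hp.2
    rw [integrable_prod_iff hm]
    refine ⟨Eventually.of_forall hGi, ?_⟩
    simp only [Function.uncurry_apply_pair, hGnorm]
    exact integrable_const (_ : ℝ)
  have hswap := integral_integral_swap hfub
  have hinner : ∀ u ∈ B, ∫ θ in Set.Ioc 0 (2 * Real.pi), G θ u =
      (ρ u : ℂ) * ((2 * Real.pi : ℝ) * h 0) := by
    intro u hu
    have hd : DiffContOnCl ℂ (fun t : ℂ => h (t • u)) (Metric.ball 0 |1|) := by
      rw [abs_one]
      refine DifferentiableOn.diffContOnCl_ball (U := Metric.closedBall 0 1) (fun t ht => ?_)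
        le_rfl
      have h1 := hh.differentiableAt (Metric.isOpen_ball.mem_nhds
        (hmem t (by simpa using ht) u hu))
      exact (h1.comp t (by fun_prop)).differentiableWithinAt
    have h2 := hd.circleAverage
    rw [Real.circleAverage_def, zero_smul, intervalIntegral.integral_of_le
      (by positivity)] at h2
    simp only [G]
    rw [integral_const_mul, ← h2, Complex.real_smul, ← mul_assoc ((2 * Real.pi : ℝ) : ℂ),
      ← Complex.ofReal_mul, mul_inv_cancel₀ (by positivity), Complex.ofReal_one, one_mul]
  rw [setIntegral_congr_fun Metric.isOpen_ball.measurableSet hinner, integral_mul_const] at hswap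
  simp only [hGint, integral_const, MeasurableSet.univ, measureReal_restrict_apply,
    Set.univ_inter, Real.volume_real_Ioc_of_le (show 0 ≤ 2 * Real.pi by positivity), sub_zero,
    Complex.real_smul] at hswap
  have hpi : ((2 * Real.pi : ℝ) : ℂ) ≠ 0 := Complex.ofReal_ne_zero.2 (by positivity)
  refine mul_left_cancel₀ hpi (hswap.trans ?_)
  ring

/-- The square of the norm of a holomorphic function satisfies the sub-mean value property. -/
lemma norm_sq_mul_volume_le {h : E → ℂ} {w : E} {R : ℝ}
    (hh : DifferentiableOn ℂ h (Metric.ball w R)) :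
    ENNReal.ofReal (‖h w‖ ^ 2) * volume (Metric.ball (0 : E) R) ≤
      ∫⁻ u in Metric.ball w R, ENNReal.ofReal (‖h u‖ ^ 2) := by
  have hmaps : ∀ u ∈ Metric.ball (0 : E) R, w + u ∈ Metric.ball w R := fun u hu => by
    simpa using hu
  -- The mean value property is applied to the holomorphic function `h ^ 2`, whose absolute value is
  -- `‖h‖ ^ 2`. Nothing is to be shown when the right-hand side is infinite.
  have hd : DifferentiableOn ℂ (fun u => h (w + u) ^ 2) (Metric.ball 0 R) :=
    (hh.comp (by fun_prop) hmaps).pow 2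
  have htrans : ∫⁻ u in Metric.ball w R, ENNReal.ofReal (‖h u‖ ^ 2) =
      ∫⁻ u in Metric.ball (0 : E) R, ENNReal.ofReal (‖h (w + u)‖ ^ 2) := by
    rw [← (measurePreserving_add_left volume w).setLIntegral_comp_preimage_emb
      (measurableEmbedding_addLeft w) (fun u => ENNReal.ofReal (‖h u‖ ^ 2))]
    congr 2
    ext u
    simp
  rw [htrans]
  by_cases hfin : ∫⁻ u in Metric.ball (0 : E) R, ENNReal.ofReal (‖h (w + u)‖ ^ 2) = ⊤
  · rw [hfin]; exact le_top
  have henorm : ∀ u : E, ‖h (w + u) ^ 2‖ₑ = ENNReal.ofReal (‖h (w + u)‖ ^ 2) := fun u => by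
    rw [← ofReal_norm, norm_pow]
  have hint : IntegrableOn (fun u => ((1 : ℝ) : ℂ) * h (w + u) ^ 2) (Metric.ball 0 R) := by
    simp only [Complex.ofReal_one, one_mul]
    refine ⟨hd.continuousOn.aestronglyMeasurable Metric.isOpen_ball.measurableSet, ?_⟩
    rw [hasFiniteIntegral_iff_enorm]
    simp only [henorm]
    exact lt_top_iff_ne_top.2 hfin
  have hmv := setIntegral_weight_mul (ρ := fun _ => 1) hd continuousOn_const (fun _ _ _ => rfl)
    hint
  simp only [Complex.ofReal_one, one_mul, integral_const, MeasurableSet.univ,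
    measureReal_restrict_apply, Set.univ_inter, add_zero] at hmv
  have h3 := enorm_integral_le_lintegral_enorm (μ := volume.restrict (Metric.ball (0 : E) R))
    (fun u => h (w + u) ^ 2)
  rw [hmv, enorm_mul] at h3
  simp only [henorm] at h3
  have h4 := henorm 0
  rw [add_zero] at h4
  rw [h4] at h3
  convert h3 using 2
  rw [Complex.real_smul, mul_one, ← ofReal_norm, Complex.norm_real,
    Real.norm_of_nonneg measureReal_nonneg, ofReal_measureReal measure_ball_lt_top.ne]

end MeanValue

/-! ### The automorphy factors `Cz + D`, the Jacobian and their cocycle identities. -/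

section Action

/-- The denominator `Cz + D` of the fractional linear transformation of `g`. -/
def den (g : SU21) (z : E) : ℂ := (mat g *ᵥ lift z) 2

lemma mulVec_lift (A : Matrix (Fin 3) (Fin 3) ℂ) (z : E) (i : Fin 3) :
    (A *ᵥ lift z) i = A i 0 * z 0 + A i 1 * z 1 + A i 2 := by
  simp [mulVec, dotProduct, Fin.sum_univ_three, lift]

lemma den_eq (g : SU21) (z : E) : den g z = mat g 2 0 * z 0 + mat g 2 1 * z 1 + mat g 2 2 :=
  mulVec_lift _ _ _

lemma den_ne_zero (g : SU21) {z : E} (hz : z ∈ Metric.ball (0 : E) 1) : den g z ≠ 0 :=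
  denom_ne_zero g ⟨z, hz⟩

lemma moebius_apply (g : SU21) (z : E) (i : Fin 2) : moebius (mat g) z i =
    (mat g i.castSucc 0 * z 0 + mat g i.castSucc 1 * z 1 + mat g i.castSucc 2) / den g z := by
  fin_cases i <;> simp [moebius, mulVec_lift, den_eq]

lemma smul_val (g : SU21) (z : Ball2) : (g • z).1 = moebius (mat g) z.1 := rfl

lemma norm_sq_eq (z : E) : ‖z‖ ^ 2 = ‖z 0‖ ^ 2 + ‖z 1‖ ^ 2 := by
  rw [EuclideanSpace.norm_sq_eq, Fin.sum_univ_two]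

/-- The factor `1 - |z|²`. -/
def wt (z : Ball2) : ℝ := 1 - ‖z.1‖ ^ 2

lemma wt_pos (z : Ball2) : 0 < wt z := by
  have := mem_ball_zero_iff.1 z.2
  rw [wt]
  nlinarith [norm_nonneg z.1]

lemma wt_le_one (z : Ball2) : wt z ≤ 1 := by
  rw [wt]
  nlinarith [norm_nonneg z.1]

/-- This is invariance of the Hermitian form on the lift of `z`, divided by the squared modulus of
the last coordinate. -/
lemma wt_smul (g : SU21) (z : Ball2) : wt (g • z) * ‖den g z.1‖ ^ 2 = wt z := by
  have h := norm_mulVec_lift g z.1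
  have h0 := den_ne_zero g z.2
  have h0' : ‖den g z.1‖ ≠ 0 := norm_ne_zero_iff.2 h0
  rw [wt, wt, smul_val, norm_sq_eq, norm_sq_eq]
  simp only [moebius, PiLp.toLp_apply, Matrix.cons_val_zero, Matrix.cons_val_one, norm_div]
  rw [show (mat g *ᵥ lift z.1) 2 = den g z.1 from rfl] at *
  field_simp
  linarith

lemma hasDerivAt_moebius_line (g : SU21) {z : E} (hz : z ∈ Metric.ball (0 : E) 1) (v : E)
    (i : Fin 2) : HasDerivAt (fun t : ℂ => moebius (mat g) (z + t • v) i)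
      (((mat g i.castSucc 0 * v 0 + mat g i.castSucc 1 * v 1) * den g z -
        (mat g i.castSucc 0 * z 0 + mat g i.castSucc 1 * z 1 + mat g i.castSucc 2) *
          (mat g 2 0 * v 0 + mat g 2 1 * v 1)) / den g z ^ 2) 0 := by
  have key (a b c : ℂ) : HasDerivAt
      (fun t : ℂ => a * (z + t • v) 0 + b * (z + t • v) 1 + c) (a * v 0 + b * v 1) 0 := by
    have h1 (j : Fin 2) : HasDerivAt (fun t : ℂ => (z + t • v) j) (v j) 0 := by
      simpa using ((hasDerivAt_id (0 : ℂ)).mul_const (v j)).const_add (z j)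
    exact (((h1 0).const_mul a).add ((h1 1).const_mul b)).add_const c
  have h0 : den g (z + (0 : ℂ) • v) ≠ 0 := by simpa using den_ne_zero g hz
  have h2 := (key (mat g i.castSucc 0) (mat g i.castSucc 1) (mat g i.castSucc 2)).div
    (key (mat g 2 0) (mat g 2 1) (mat g 2 2)) (by rwa [← den_eq])
  simp only [moebius_apply, den_eq]
  exact h2.congr_deriv (by simp)

lemma differentiableAt_moebius (g : SU21) {z : E} (hz : z ∈ Metric.ball (0 : E) 1) :
    DifferentiableAt ℂ (moebius (mat g)) z := by
  rw [differentiableAt_euclidean]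
  intro i
  simp only [moebius_apply, div_eq_mul_inv]
  have h1 : DifferentiableAt ℂ (fun z : E =>
      mat g i.castSucc 0 * z 0 + mat g i.castSucc 1 * z 1 + mat g i.castSucc 2) z := by fun_prop
  have h2 : DifferentiableAt ℂ (den g) z := by
    simp only [funext (den_eq g)]
    fun_prop
  exact h1.mul (h2.inv (den_ne_zero g hz))

lemma fderiv_moebius_apply (g : SU21) {z : E} (hz : z ∈ Metric.ball (0 : E) 1) (v : E)
    (i : Fin 2) : fderiv ℂ (moebius (mat g)) z v i =
      ((mat g i.castSucc 0 * v 0 + mat g i.castSucc 1 * v 1) * den g z -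
        (mat g i.castSucc 0 * z 0 + mat g i.castSucc 1 * z 1 + mat g i.castSucc 2) *
          (mat g 2 0 * v 0 + mat g 2 1 * v 1)) / den g z ^ 2 := by
  have h1 := hasDerivAt_line (f := moebius (mat g)) (z := z) (v := v) (t := 0)
    (by simpa using differentiableAt_moebius g hz)
  rw [zero_smul, add_zero] at h1
  have h2 := (EuclideanSpace.proj i : E →L[ℂ] ℂ).hasFDerivAt.comp_hasDerivAt (0 : ℂ) h1
  exact h2.unique (hasDerivAt_moebius_line g hz v i)

lemma det_mat (g : SU21) : (mat g).det = 1 := g.1.2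

/-- By the quotient rule the determinant has numerator `den * det g` over `den ^ 4`, and `det g =
1`. -/
lemma jacobian_eq (g : SU21) (z : Ball2) : jacobian g z = (den g z.1 ^ 3)⁻¹ := by
  have h0 := den_ne_zero g z.2
  rw [jacobian, ContinuousLinearMap.det,
    ← LinearMap.det_toMatrix (EuclideanSpace.basisFun (Fin 2) ℂ).toBasis, det_fin_two]
  simp only [LinearMap.toMatrix_apply, OrthonormalBasis.coe_toBasis,
    OrthonormalBasis.coe_toBasis_repr_apply, EuclideanSpace.basisFun_repr,
    EuclideanSpace.basisFun_apply, ContinuousLinearMap.coe_coe, fderiv_moebius_apply g z.2]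
  have hdet := det_mat g
  rw [det_fin_three] at hdet
  simp
  field_simp
  rw [den_eq] at *
  linear_combination (mat g 2 0 * z.1 0 + mat g 2 1 * z.1 1 + mat g 2 2) * hdet

lemma jacobian_ne_zero (g : SU21) (z : Ball2) : jacobian g z ≠ 0 := by
  rw [jacobian_eq]
  exact inv_ne_zero (pow_ne_zero _ (den_ne_zero g z.2))

lemma den_mul (g h : SU21) (z : Ball2) :
    den (g * h) z.1 = den g (h • z).1 * den h z.1 := by
  have h1 : mat (g * h) *ᵥ lift z.1 = mat g *ᵥ (mat h *ᵥ lift z.1) := by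
    rw [mulVec_mulVec, mat_mul]
  have h2 := denom_ne_zero h z
  rw [den, den, smul_val, lift_moebius, mulVec_smul, h1, den, Pi.smul_apply, smul_eq_mul]
  field_simp

lemma jacobian_mul (g h : SU21) (z : Ball2) :
    jacobian (g * h) z = jacobian g (h • z) * jacobian h z := by
  rw [jacobian_eq, jacobian_eq, jacobian_eq, den_mul, mul_pow, mul_inv]

lemma jacobian_one (z : Ball2) : jacobian 1 z = 1 := by
  have h := jacobian_mul 1 1 z
  rw [one_mul, one_smul] at h
  exact (mul_eq_right₀ (jacobian_ne_zero 1 z)).1 h.symm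

/-- The source of both invariances used later: that of the hyperbolic volume and that of the
point-wise norm of sections. -/
lemma wt_smul_pow_three (g : SU21) (z : Ball2) :
    wt (g • z) ^ 3 = wt z ^ 3 * ‖jacobian g z‖ ^ 2 := by
  have h0 : ‖den g z.1‖ ≠ 0 := norm_ne_zero_iff.2 (den_ne_zero g z.2)
  rw [← wt_smul g z, jacobian_eq, norm_inv, norm_pow]
  field_simp

instance : ContinuousConstSMul SU21 Ball2 where
  continuous_const_smul g := by
    refine Continuous.subtype_mk ?_ _
    exact continuous_iff_continuousAt.2 fun z =>
      ((differentiableAt_moebius g z.2).continuousAt.comp continuousAt_subtype_val)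

lemma differentiableOn_extendZero_jacobian (g : SU21) :
    DifferentiableOn ℂ (extendZero (jacobian g)) (Metric.ball 0 1) := by
  have h : DifferentiableOn ℂ (fun z => (den g z ^ 3)⁻¹) (Metric.ball 0 1) := by
    refine DifferentiableOn.inv (DifferentiableOn.pow ?_ 3) fun z hz =>
      pow_ne_zero _ (den_ne_zero g hz)
    simp only [funext (den_eq g)]
    fun_prop
  exact h.congr fun z hz => by rw [extendZero_apply _ hz, jacobian_eq]

lemma IsHolomorphic.continuous {f : Ball2 → ℂ} (hf : IsHolomorphic f) : Continuous f := by
  have h := continuousOn_iff_continuous_domRestrict.1 hf.continuousOn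
  convert h using 1
  ext z
  rw [Set.domRestrict_apply, extendZero_apply _ z.2]

lemma continuous_jacobian (g : SU21) : Continuous (jacobian g) :=
  IsHolomorphic.continuous (differentiableOn_extendZero_jacobian g)

lemma continuous_wt : Continuous wt := by
  unfold wt
  fun_prop

end Action

/-! ### Transitivity on the ball by explicit Hermitian boosts. -/

section Transitivity

lemma exists_smul_eq_of_zero (z : Ball2) :
    ∃ g : SU21, g • (⟨0, Metric.mem_ball_self one_pos⟩ : Ball2) = z := by
  obtain ⟨z, hz⟩ := z
  have hlt := (mem_ball_iff z).1 hz
  set s : ℝ := Real.sqrt (1 - (‖z 0‖ ^ 2 + ‖z 1‖ ^ 2)) with hs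
  have hs0 : 0 < s := Real.sqrt_pos.2 (by linarith)
  have hs2 : s ^ 2 = 1 - (‖z 0‖ ^ 2 + ‖z 1‖ ^ 2) := Real.sq_sqrt (by linarith)
  have hsc : (s : ℂ) ≠ 0 := Complex.ofReal_ne_zero.2 hs0.ne'
  have hsc1 : (1 + s : ℂ) ≠ 0 := by
    exact_mod_cast (by positivity : (1 + s : ℝ) ≠ 0)
  have hT : z 0 * starRingEnd ℂ (z 0) + z 1 * starRingEnd ℂ (z 1) = 1 - (s : ℂ) ^ 2 := by
    rw [Complex.mul_conj, Complex.mul_conj, Complex.normSq_eq_norm_sq, Complex.normSq_eq_norm_sq]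
    have := congrArg (Complex.ofReal) hs2
    push_cast at this ⊢
    linear_combination this
  set a := z 0
  set b := z 1
  set a' := starRingEnd ℂ a with ha'
  set b' := starRingEnd ℂ b with hb'
  obtain ⟨q, hq⟩ : ∃ q : ℝ, q = s⁻¹ := ⟨_, rfl⟩
  obtain ⟨p, hp⟩ : ∃ p : ℝ, p = (s * (1 + s))⁻¹ := ⟨_, rfl⟩
  have hs1 : (1 + s : ℝ) ≠ 0 := by positivity
  have hqs : (q : ℂ) * s = 1 := by
    have : q * s = 1 := by rw [hq]; field_simp
    exact_mod_cast this
  have hps : (p : ℂ) * (s * (1 + s)) = 1 := by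
    have : p * (s * (1 + s)) = 1 := by rw [hp]; field_simp
    exact_mod_cast this
  have hpq : (1 : ℂ) + p * (1 - s ^ 2) = q := by
    have : 1 + p * (1 - s ^ 2) = q := by rw [hp, hq]; field_simp; ring
    exact_mod_cast this
  have hpq2 : (2 : ℂ) * p + p ^ 2 * (1 - s ^ 2) = q ^ 2 := by
    have : 2 * p + p ^ 2 * (1 - s ^ 2) = q ^ 2 := by rw [hp, hq]; field_simp; ring
    exact_mod_cast this
  have hpq3 : (q : ℂ) * (1 + (p - q) * (1 - s ^ 2)) = 1 := by
    have : q * (1 + (p - q) * (1 - s ^ 2)) = 1 := by rw [hp, hq]; field_simp; ring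
    exact_mod_cast this
  -- The boost with last column `q (z, 1)`, where `q = 1/s`. The block `1 + p z z*` is the positive
  -- square root of `1 + q² z z*`; since `|z|² = 1 - s²`, this forces `2p + p² (1 - s²) = q²`,
  -- solved by `p = 1/(s(1+s))`.
  let A : Matrix (Fin 3) (Fin 3) ℂ :=
    !![1 + p * a * a', p * a * b', q * a; p * b * a', 1 + p * b * b', q * b; q * a', q * b', q]
  have hdet : A.det = 1 := by
    rw [det_fin_three]
    simp [A]
    linear_combination hpq3 + q * (p - q) * hT
  have hstar : Aᴴ = A := by
    ext i j
    fin_cases i <;> fin_cases j <;>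
      simp [A, conjTranspose_apply, ha', hb'] <;> ring
  have hunit : Aᴴ * H * A = H := by
    rw [hstar]
    ext i j
    fin_cases i <;> fin_cases j <;>
      simp [A, H, Matrix.mul_apply, Fin.sum_univ_three, vecMul_diagonal]
    · linear_combination a * a' * hpq2 + p ^ 2 * a * a' * hT
    · linear_combination a * b' * hpq2 + p ^ 2 * a * b' * hT
    · linear_combination q * a * hpq + p * q * a * hT
    · linear_combination b * a' * hpq2 + p ^ 2 * b * a' * hT
    · linear_combination b * b' * hpq2 + p ^ 2 * b * b' * hT
    · linear_combination q * b * hpq + p * q * b * hT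
    · linear_combination q * a' * hpq + p * q * a' * hT
    · linear_combination q * b' * hpq + p * q * b' * hT
    · linear_combination q ^ 2 * hT - (q * s + 1) * hqs
  refine ⟨⟨⟨A, hdet⟩, hunit⟩, Subtype.ext ?_⟩
  have hq0 : (q : ℂ) ≠ 0 := left_ne_zero_of_mul_eq_one hqs
  ext i
  fin_cases i
  · simp [smul_val, moebius, mulVec_lift, mat, A, a]
    field_simp
  · simp [smul_val, moebius, mulVec_lift, mat, A, b]
    field_simp

end Transitivity

/-! ### Change of variables and invariance of the hyperbolic measure. -/

section Measure

/-- Lebesgue measure on the ball. -/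
def eucMeasure : Measure Ball2 := Measure.comap (Subtype.val : Ball2 → E) volume

lemma measurableSet_ball : MeasurableSet (Metric.ball (0 : E) 1) :=
  Metric.isOpen_ball.measurableSet

instance : IsFiniteMeasure eucMeasure := by
  constructor
  rw [eucMeasure, comap_subtype_coe_apply measurableSet_ball]
  exact (measure_mono (Set.image_subset_iff.2 fun z _ => z.2)).trans_lt
    (measure_ball_lt_top (x := (0 : E)) (r := 1))

lemma hypMeasure_eq : hypMeasure =
    eucMeasure.withDensity fun z => ENNReal.ofReal ((wt z ^ 3)⁻¹) := rfl

lemma measurable_hypDensity : Measurable fun z : Ball2 => ENNReal.ofReal ((wt z ^ 3)⁻¹) :=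
  ENNReal.measurable_ofReal.comp ((continuous_wt.measurable.pow_const 3).inv)

lemma lintegral_hypMeasure (f : Ball2 → ENNReal) :
    ∫⁻ z, f z ∂hypMeasure = ∫⁻ z, ENNReal.ofReal ((wt z ^ 3)⁻¹) * f z ∂eucMeasure := by
  rw [hypMeasure_eq, lintegral_withDensity_eq_lintegral_mul_non_measurable _
    measurable_hypDensity (Eventually.of_forall fun _ => ENNReal.ofReal_lt_top)]
  rfl

lemma integral_hypMeasure (f : Ball2 → ℂ) :
    ∫ z, f z ∂hypMeasure = ∫ z, ((wt z ^ 3)⁻¹ : ℝ) * f z ∂eucMeasure := by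
  rw [hypMeasure_eq, integral_withDensity_eq_integral_toReal_smul measurable_hypDensity
    (Eventually.of_forall fun _ => ENNReal.ofReal_lt_top)]
  refine integral_congr_ae (Eventually.of_forall fun z => ?_)
  have := wt_pos z
  simp only [Complex.real_smul]
  rw [ENNReal.toReal_ofReal (by positivity)]

lemma lintegral_eucMeasure (f : E → ENNReal) :
    ∫⁻ z : Ball2, f z.1 ∂eucMeasure = ∫⁻ z in Metric.ball (0 : E) 1, f z :=
  lintegral_subtype_comap measurableSet_ball f

lemma integral_eucMeasure (f : E → ℂ) :
    ∫ z : Ball2, f z.1 ∂eucMeasure = ∫ z in Metric.ball (0 : E) 1, f z :=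
  integral_subtype_comap measurableSet_ball f

lemma abs_det_fderiv_moebius (g : SU21) (z : Ball2) :
    |((fderiv ℂ (moebius (mat g)) z.1).restrictScalars ℝ).det| = ‖jacobian g z‖ ^ 2 := by
  have h := LinearMap.det_restrictScalars (R := ℝ)
    (f := (fderiv ℂ (moebius (mat g)) z.1 : E →ₗ[ℂ] E))
  rw [Algebra.norm_complex_apply, Complex.normSq_eq_norm_sq] at h
  rw [jacobian, ContinuousLinearMap.det, ContinuousLinearMap.det]
  exact (congrArg abs h).trans (abs_of_nonneg (sq_nonneg _))

/-- Change of variables for a bijection of the ball: the real Jacobian of a holomorphic map is the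
squared modulus of the complex one. -/
lemma lintegral_smul_mul_jacobian (g : SU21) (φ : Ball2 → ENNReal) :
    ∫⁻ z, ENNReal.ofReal (‖jacobian g z‖ ^ 2) * φ (g • z) ∂eucMeasure =
      ∫⁻ z, φ z ∂eucMeasure := by
  classical
  let Φ : E → ENNReal := fun x => if h : x ∈ Metric.ball (0 : E) 1 then φ ⟨x, h⟩ else 0
  have hΦ : ∀ z : Ball2, Φ z.1 = φ z := fun z => dif_pos z.2
  have himg : moebius (mat g) '' Metric.ball (0 : E) 1 = Metric.ball (0 : E) 1 := by
    ext x
    constructor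
    · rintro ⟨y, hy, rfl⟩
      exact moebius_mem_ball g ⟨y, hy⟩
    · intro hx
      refine ⟨(g⁻¹ • (⟨x, hx⟩ : Ball2)).1, (g⁻¹ • (⟨x, hx⟩ : Ball2)).2, ?_⟩
      rw [← smul_val, smul_inv_smul]
  have hinj : Set.InjOn (moebius (mat g)) (Metric.ball (0 : E) 1) := by
    intro x hx y hy hxy
    have : g • (⟨x, hx⟩ : Ball2) = g • (⟨y, hy⟩ : Ball2) := Subtype.ext hxy
    exact congrArg Subtype.val (smul_left_cancel g this)
  have h := lintegral_image_eq_lintegral_abs_det_fderiv_mul volume measurableSet_ball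
    (fun x hx => ((differentiableAt_moebius g hx).hasFDerivAt.restrictScalars
      ℝ).hasFDerivWithinAt) hinj Φ
  rw [himg, ← lintegral_eucMeasure, ← lintegral_eucMeasure] at h
  simp only [hΦ, abs_det_fderiv_moebius, ← smul_val] at h
  exact h.symm

lemma lintegral_smul_hypMeasure (g : SU21) (φ : Ball2 → ENNReal) :
    ∫⁻ z, φ (g • z) ∂hypMeasure = ∫⁻ z, φ z ∂hypMeasure := by
  rw [lintegral_hypMeasure, lintegral_hypMeasure,
    ← lintegral_smul_mul_jacobian g fun z => ENNReal.ofReal ((wt z ^ 3)⁻¹) * φ z]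
  refine lintegral_congr fun z => ?_
  rw [← mul_assoc, ← ENNReal.ofReal_mul (by positivity)]
  congr 2
  have h1 := wt_pos z
  have h3 : 0 < ‖jacobian g z‖ := norm_pos_iff.2 (jacobian_ne_zero g z)
  rw [wt_smul_pow_three]
  field_simp

instance : SMulInvariantMeasure SU21 Ball2 hypMeasure where
  measure_preimage_smul g s (hs : MeasurableSet s) := by
    have h := lintegral_smul_hypMeasure g (s.indicator 1)
    rw [lintegral_indicator_one hs] at h
    rw [← h, ← lintegral_indicator_one (hs.preimage (measurable_const_smul g))]
    rfl

instance (Γ : Subgroup SU21) : ContinuousConstSMul Γ Ball2 where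
  continuous_const_smul γ := continuous_const_smul (γ : SU21)

instance (Γ : Subgroup SU21) : SMulInvariantMeasure Γ Ball2 hypMeasure where
  measure_preimage_smul γ s _ := measure_preimage_smul hypMeasure (γ : SU21) s

end Measure

/-! ### Matrix estimates, proper discontinuity, freeness, and a compact set meeting every orbit. -/

section ProperlyDiscontinuous

lemma H_mul_H : H * H = 1 := by
  rw [H, diagonal_mul_diagonal, ← diagonal_one]
  congr 1
  ext i
  fin_cases i <;> simp

lemma mat_inv (g : SU21) : mat g⁻¹ = H * (mat g)ᴴ * H := by
  have hg : (mat g)ᴴ * H * mat g = H := g.2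
  have h1 : H * (mat g)ᴴ * H * mat g = 1 := by
    rw [Matrix.mul_assoc H, Matrix.mul_assoc, hg, H_mul_H]
  have h2 : mat g * mat g⁻¹ = 1 := by
    rw [← mat_mul, mul_inv_cancel]
    simp [mat]
  exact (left_inv_eq_right_inv h1 h2).symm

lemma norm_mat_inv_apply (g : SU21) (i : Fin 3) : ‖mat g⁻¹ i 2‖ = ‖mat g 2 i‖ := by
  rw [mat_inv]
  fin_cases i <;> simp [H, conjTranspose_apply]

lemma norm_sq_col_eq (g : SU21) (j : Fin 3) :
    ‖mat g 0 j‖ ^ 2 + ‖mat g 1 j‖ ^ 2 - ‖mat g 2 j‖ ^ 2 =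
      ‖(Pi.single j 1 : Fin 3 → ℂ) 0‖ ^ 2 + ‖(Pi.single j 1 : Fin 3 → ℂ) 1‖ ^ 2 -
        ‖(Pi.single j 1 : Fin 3 → ℂ) 2‖ ^ 2 := by
  have h := hermForm_mulVec g (Pi.single j 1)
  rw [hermForm_eq, hermForm_eq] at h
  simpa only [mulVec_single_one, col_apply] using Complex.ofReal_injective h

lemma norm_sq_row (g : SU21) : ‖mat g 2 0‖ ^ 2 + ‖mat g 2 1‖ ^ 2 + 1 = ‖mat g 2 2‖ ^ 2 := by
  have h := norm_sq_col_eq g⁻¹ 2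
  simp only [norm_mat_inv_apply] at h
  simp at h
  linarith

lemma norm_sq_col (g : SU21) (j : Fin 3) :
    ‖mat g 0 j‖ ^ 2 + ‖mat g 1 j‖ ^ 2 ≤ 1 + ‖mat g 2 j‖ ^ 2 := by
  have h := norm_sq_col_eq g j
  fin_cases j <;> simp at h ⊢ <;> linarith

lemma one_le_norm_mat (g : SU21) : 1 ≤ ‖mat g 2 2‖ := by
  have := norm_sq_row g
  nlinarith [sq_nonneg ‖mat g 2 0‖, sq_nonneg ‖mat g 2 1‖, norm_nonneg (mat g 2 2)]

lemma norm_linear_part_le (g : SU21) (z : E) :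
    ‖mat g 2 0 * z 0 + mat g 2 1 * z 1‖ ≤
      Real.sqrt (‖mat g 2 0‖ ^ 2 + ‖mat g 2 1‖ ^ 2) * ‖z‖ := by
  have h1 : ‖mat g 2 0 * z 0 + mat g 2 1 * z 1‖ ≤
      ‖mat g 2 0‖ * ‖z 0‖ + ‖mat g 2 1‖ * ‖z 1‖ := by
    simpa only [norm_mul] using norm_add_le (mat g 2 0 * z 0) (mat g 2 1 * z 1)
  refine h1.trans (abs_le_of_sq_le_sq' ?_ (by positivity)).2
  rw [mul_pow, Real.sq_sqrt (by positivity), norm_sq_eq]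
  nlinarith [sq_nonneg (‖mat g 2 0‖ * ‖z 1‖ - ‖mat g 2 1‖ * ‖z 0‖)]

lemma norm_den_ge (g : SU21) (z : E) :
    ‖mat g 2 2‖ - Real.sqrt (‖mat g 2 0‖ ^ 2 + ‖mat g 2 1‖ ^ 2) * ‖z‖ ≤ ‖den g z‖ := by
  have h := norm_sub_le (den g z) (mat g 2 0 * z 0 + mat g 2 1 * z 1)
  rw [den_eq, add_sub_cancel_left, ← den_eq] at h
  linarith [norm_linear_part_le g z]

lemma sqrt_row_le (g : SU21) :
    Real.sqrt (‖mat g 2 0‖ ^ 2 + ‖mat g 2 1‖ ^ 2) ≤ ‖mat g 2 2‖ := by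
  rw [Real.sqrt_le_left (norm_nonneg _)]
  linarith [norm_sq_row g]

lemma one_sub_mul_norm_mat_le (g : SU21) (z : E) : (1 - ‖z‖) * ‖mat g 2 2‖ ≤ ‖den g z‖ := by
  nlinarith [norm_den_ge g z, mul_le_mul_of_nonneg_right (sqrt_row_le g) (norm_nonneg z)]

/-- The denominator of a transformation is bounded away from zero on the ball. -/
lemma one_le_two_mul_norm_mat_mul (g : SU21) (z : Ball2) :
    1 ≤ 2 * ‖mat g 2 2‖ * ‖den g z.1‖ := by
  set c := Real.sqrt (‖mat g 2 0‖ ^ 2 + ‖mat g 2 1‖ ^ 2) with hc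
  have hc0 : 0 ≤ c := Real.sqrt_nonneg _
  -- With `D = mat g 2 2`, this gives `‖D‖ - c = 1/(‖D‖ + c) ≥ 1/(2‖D‖)`, and `‖den‖ ≥ ‖D‖ - c` on
  -- the whole ball.
  have hc2 : c ^ 2 + 1 = ‖mat g 2 2‖ ^ 2 := by
    rw [hc, Real.sq_sqrt (by positivity), norm_sq_row]
  have h1 := norm_den_ge g z.1
  have h2 : c * ‖z.1‖ ≤ c := by
    have := (mem_ball_zero_iff.1 z.2).le
    nlinarith
  have h3 := sqrt_row_le g
  rw [← hc] at h1 h3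
  nlinarith [norm_nonneg (mat g 2 2)]

variable (Γ : Subgroup SU21)

instance secondCountableTopology_matrix : SecondCountableTopology (Matrix (Fin 3) (Fin 3) ℂ) :=
  inferInstanceAs (SecondCountableTopology (Fin 3 → Fin 3 → ℂ))

instance secondCountableTopology_SU21 : SecondCountableTopology SU21 :=
  (SpecialLinearGroup.isClosedEmbedding_val.isEmbedding.comp
    (IsEmbedding.subtypeVal (p := (· ∈ SU21)))).secondCountableTopology

instance countable_of_discrete [DiscreteTopology Γ] : Countable Γ :=
  TopologicalSpace.separableSpace_iff_countable.1 inferInstance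

lemma isCompact_setOf_norm_mat_le (C : ℝ) :
    IsCompact {g : SU21 | ∀ i j, ‖mat g i j‖ ≤ C} := by
  have h1 : IsCompact (Set.univ.pi fun _ : Fin 3 => Set.univ.pi fun _ : Fin 3 =>
      Metric.closedBall (0 : ℂ) C) :=
    isCompact_univ_pi fun _ => isCompact_univ_pi fun _ => isCompact_closedBall _ _
  have hclosed : IsClosed (SU21 : Set (SpecialLinearGroup (Fin 3) ℂ)) := by
    have hc : Continuous fun A : SpecialLinearGroup (Fin 3) ℂ =>
        (A : Matrix (Fin 3) (Fin 3) ℂ)ᴴ * H * (A : Matrix (Fin 3) (Fin 3) ℂ) :=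
      ((continuous_subtype_val.matrix_conjTranspose).mul continuous_const).mul
        continuous_subtype_val
    exact isClosed_singleton.preimage hc
  have h2 := (SpecialLinearGroup.isClosedEmbedding_val.comp
    hclosed.isClosedEmbedding_subtypeVal).isCompact_preimage h1
  refine (congrArg IsCompact (Set.ext fun g => ?_)).mpr h2
  exact ⟨fun h i _ j _ => mem_closedBall_zero_iff.2 (h i j),
    fun h i j => mem_closedBall_zero_iff.1 (h i trivial j trivial)⟩

/-- A discrete subgroup acts properly discontinuously. -/
lemma finite_setOf_smul_mem [DiscreteTopology Γ] {r : ℝ} (hr : r < 1) :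
    {γ : Γ | ∃ x : Ball2, ‖x.1‖ ≤ r ∧ ‖(γ • x).1‖ ≤ r}.Finite := by
  -- `wt (γ • x) ‖den‖² = wt x ≤ 1` bounds `‖den‖²` by `1/(1 - r²)`, and `‖den‖ ≥ (1 - r) ‖mat γ 2
  -- 2‖`. So `D` bounds the squared last row; the column identities then bound every squared entry
  -- by `1 + D`, hence every entry by `1 + D`.
  set D := 1 / ((1 - r) ^ 2 * (1 - r ^ 2)) with hD
  have hcomp := isCompact_setOf_norm_mat_le (1 + D)
  have hemb : IsClosedEmbedding (Subtype.val : Γ → SU21) :=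
    (Subgroup.isClosed_of_discrete (H := Γ)).isClosedEmbedding_subtypeVal
  have hfin := (hemb.isCompact_preimage hcomp).finite_of_discrete
  refine hfin.subset ?_
  rintro γ ⟨x, hx, hγx⟩ i j
  have hr0 : 0 ≤ r := (norm_nonneg _).trans hx
  have h1 := wt_smul (γ : SU21) x
  have h2 := one_sub_mul_norm_mat_le (γ : SU21) x.1
  have h3 := wt_le_one x
  have h4 : 1 - r ^ 2 ≤ wt ((γ : SU21) • x) := by
    have : ‖((γ : SU21) • x).1‖ ≤ r := hγx
    rw [wt]
    nlinarith [norm_nonneg ((γ : SU21) • x).1]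
  have hr2 : 0 < 1 - r ^ 2 := by nlinarith
  have hr1 : 0 < 1 - r := by linarith
  have h5 : (1 - r) * ‖mat γ.1 2 2‖ ≤ ‖den γ.1 x.1‖ := by
    nlinarith [norm_nonneg (mat γ.1 2 2)]
  have h6 : ((1 - r) * ‖mat γ.1 2 2‖) ^ 2 ≤ ‖den γ.1 x.1‖ ^ 2 :=
    pow_le_pow_left₀ (by positivity) h5 2
  have h7 : ‖mat γ.1 2 2‖ ^ 2 ≤ D := by
    rw [hD, le_div_iff₀ (by positivity)]
    nlinarith [sq_nonneg ‖den γ.1 x.1‖]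
  have hrow := norm_sq_row γ.1
  have hcol := norm_sq_col γ.1 j
  have h2j : ‖mat γ.1 2 j‖ ^ 2 ≤ D := by
    fin_cases j <;> simp <;>
      nlinarith [sq_nonneg ‖mat γ.1 2 0‖, sq_nonneg ‖mat γ.1 2 1‖]
  have hij : ‖mat γ.1 i j‖ ^ 2 ≤ 1 + D := by
    fin_cases i <;> simp <;>
      nlinarith [sq_nonneg ‖mat γ.1 0 j‖, sq_nonneg ‖mat γ.1 1 j‖]
  have hD0 : 0 ≤ D := by positivity
  nlinarith [norm_nonneg (mat γ.1 i j)]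

/-- The number of translates of a point in a relatively compact ball is bounded. -/
lemma exists_tsum_indicator_le [DiscreteTopology Γ] {r : ℝ} (hr : r < 1) :
    ∃ N : ℕ, ∀ y : Ball2,
      ∑' γ : Γ, ({x : Ball2 | ‖x.1‖ ≤ r}.indicator 1 (γ • y) : ENNReal) ≤ N := by
  classical
  set S := {x : Ball2 | ‖x.1‖ ≤ r} with hS
  have hfin := finite_setOf_smul_mem Γ hr
  refine ⟨hfin.toFinset.card, fun y => ?_⟩
  by_cases hy : ∃ γ₀ : Γ, γ₀ • y ∈ S
  · obtain ⟨γ₀, h₀⟩ := hy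
    -- Reindexing by `γ₀` replaces `y` by the point `γ₀ • y` of the ball of radius `r`. The
    -- contributing elements then lie in a finite set that does not depend on `y`.
    rw [← (Equiv.mulRight γ₀).tsum_eq, tsum_eq_sum (s := hfin.toFinset)]
    · refine (Finset.sum_le_sum (g := fun _ => 1) fun γ _ => ?_).trans_eq (by simp)
      exact Set.indicator_le_self' (fun _ _ => zero_le) _
    · intro γ hγ
      rw [Set.indicator_of_notMem]
      intro hmem
      refine hγ (hfin.mem_toFinset.2 ⟨γ₀ • y, h₀, ?_⟩)
      rwa [Equiv.coe_mulRight, mul_smul] at hmem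
  · push Not at hy
    simp [Set.indicator_of_notMem (hy _)]

/-- All powers of an element fixing `z` lie in the finite set of proper discontinuity with `r =
‖z‖`, so such an element has finite order. -/
lemma smul_ne_of_torsionFree [DiscreteTopology Γ]
    (htf : ∀ γ ∈ Γ, IsOfFinOrder γ → γ = 1) {γ : Γ} (hγ : γ ≠ 1) (z : Ball2) : γ • z ≠ z := by
  intro h
  have hfin := finite_setOf_smul_mem Γ (mem_ball_zero_iff.1 z.2)
  have hpow : ∀ n : ℕ, γ ^ n • z = z := fun n => by
    induction n with
    | zero => simp
    | succ n ih => rw [pow_succ, mul_smul, h, ih]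
  have : IsOfFinOrder γ := by
    by_contra hinf
    refine Set.infinite_range_of_injective (injective_pow_iff_not_isOfFinOrder.2 hinf)
      (hfin.subset ?_)
    rintro _ ⟨n, rfl⟩
    exact ⟨z, le_rfl, by simp only [hpow]; exact le_rfl⟩
  exact hγ (Subtype.ext (htf γ.1 γ.2 ((Submonoid.isOfFinOrder_coe).2 this)))

/-- The images of the open balls of radius `1 - 1/(n+1)` form an increasing open cover of the
compact quotient, so one of them is everything. -/
lemma exists_smul_norm_le [CompactSpace (PicardSurface Γ)] :
    ∃ r : ℝ, 0 ≤ r ∧ r < 1 ∧ ∀ x : Ball2, ∃ γ : Γ, ‖(γ • x).1‖ ≤ r := by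
  let π : Ball2 → PicardSurface Γ := Quotient.mk _
  have hπ : IsOpenMap π := isOpenMap_quotient_mk'_mul
  let U : ℕ → Set (PicardSurface Γ) := fun n => π '' {x | ‖x.1‖ < 1 - 1 / ((n : ℝ) + 1)}
  obtain ⟨n, hn⟩ := isCompact_univ.elim_directed_cover U
    (fun n => hπ _ (isOpen_lt (by fun_prop) continuous_const))
    (fun q _ => by
      induction q using Quotient.inductionOn with
      | h x =>
        have hx := mem_ball_zero_iff.1 x.2
        obtain ⟨n, hn⟩ := exists_nat_one_div_lt (sub_pos.2 hx)
        exact Set.mem_iUnion.2 ⟨n, x, by simp only [Set.mem_ofPred_eq]; linarith, rfl⟩)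
    (Monotone.directed_le fun m n hmn => Set.image_mono fun x hx => by
      have : 1 / ((n : ℝ) + 1) ≤ 1 / ((m : ℝ) + 1) := by gcongr
      simp only [Set.mem_ofPred_eq] at hx ⊢
      linarith)
  have hpos : 0 < 1 / ((n : ℝ) + 1) := by positivity
  refine ⟨1 - 1 / ((n : ℝ) + 1), ?_, by linarith, fun x => ?_⟩
  · rw [sub_nonneg, div_le_one (by positivity)]
    linarith [Nat.cast_nonneg (α := ℝ) n]
  obtain ⟨y, hy, hyx⟩ := hn (Set.mem_univ (π x))
  obtain ⟨γ, hγ⟩ := Quotient.exact hyx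
  exact ⟨γ, by rw [show γ • x = y from hγ]; exact le_of_lt hy⟩

end ProperlyDiscontinuous

/-! ### Normal convergence and automorphy of Poincaré series. -/

section Poincare

lemma norm_jacobian_inv_le (g : SU21) (y : Ball2) :
    ‖jacobian g⁻¹ y‖ ≤ 8 * ‖mat g 2 2‖ ^ 3 := by
  have h := one_le_two_mul_norm_mat_mul g⁻¹ y
  rw [norm_mat_inv_apply] at h
  have h0 : 0 < ‖den g⁻¹ y.1‖ := norm_pos_iff.2 (den_ne_zero _ y.2)
  rw [jacobian_eq, norm_inv, norm_pow, inv_le_iff_one_le_mul₀ (by positivity)]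
  calc (1 : ℝ) ≤ (2 * ‖mat g 2 2‖ * ‖den g⁻¹ y.1‖) ^ 3 := one_le_pow₀ h
    _ = _ := by ring

lemma norm_jacobian_inv_mul_le (g h : SU21) (y : Ball2) :
    ‖jacobian (g⁻¹ * h) y‖ ≤ 8 * ‖mat g 2 2‖ ^ 3 * ‖jacobian h y‖ := by
  rw [jacobian_mul, norm_mul]
  exact mul_le_mul_of_nonneg_right (norm_jacobian_inv_le g _) (norm_nonneg _)

lemma norm_jacobian_zero {o : Ball2} (ho : o.1 = 0) (g : SU21) :
    ‖jacobian g o‖ * ‖mat g 2 2‖ ^ 3 = 1 := by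
  have h1 := one_le_norm_mat g
  rw [jacobian_eq, den_eq, ho]
  simp only [PiLp.zero_apply, mul_zero, zero_add, norm_inv, norm_pow]
  field_simp

/-- The bound `8 ‖mat g 2 2‖³` for the factor of `g⁻¹` is exactly compensated by `‖jacobian g o‖ =
‖mat g 2 2‖⁻³`. The constant is therefore independent of `g`, which makes the later bounds uniform
in the base point. -/
lemma norm_jacobian_conj_le {o : Ball2} (ho : o.1 = 0) (g h : SU21) :
    ‖jacobian (g⁻¹ * h * g) o‖ ≤ 8 * ‖jacobian h (g • o)‖ := by
  rw [jacobian_mul, norm_mul]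
  refine (mul_le_mul_of_nonneg_right (norm_jacobian_inv_mul_le g h _) (norm_nonneg _)).trans_eq ?_
  linear_combination 8 * ‖jacobian h (g • o)‖ * norm_jacobian_zero ho g

lemma norm_jacobian_zero_sq {o : Ball2} (ho : o.1 = 0) (g : SU21) :
    ‖jacobian g o‖ ^ 2 = wt (g • o) ^ 3 := by
  rw [wt_smul_pow_three, wt, ho]
  simp

lemma norm_jacobian_zero_le_one {o : Ball2} (ho : o.1 = 0) (g : SU21) :
    ‖jacobian g o‖ ≤ 1 := by
  have h1 := norm_jacobian_zero_sq ho g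
  have h2 : wt (g • o) ^ 3 ≤ 1 := pow_le_one₀ (wt_pos _).le (wt_le_one _)
  rw [← h1] at h2
  exact (sq_le_one_iff₀ (norm_nonneg _)).1 h2

lemma norm_jacobian_zero_lt_one {o : Ball2} (ho : o.1 = 0) {g : SU21} (hg : g • o ≠ o) :
    ‖jacobian g o‖ < 1 := by
  have h1 := norm_jacobian_zero_sq ho g
  have h2 : wt (g • o) < 1 := by
    have h3 : (g • o).1 ≠ 0 := fun h => hg (Subtype.ext (h.trans ho.symm))
    have := norm_pos_iff.2 h3
    rw [wt]
    nlinarith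
  have h4 : wt (g • o) ^ 3 < 1 := pow_lt_one₀ (wt_pos _).le h2 (by norm_num)
  rw [← h1] at h4
  exact (sq_lt_one_iff₀ (norm_nonneg _)).1 h4

variable (Γ : Subgroup SU21)

lemma setLIntegral_ball_le_eucMeasure {x : E} {δ r : ℝ} (hxr : ‖x‖ + δ ≤ r) (hr : r < 1)
    (h : Ball2 → ℂ) :
    ∫⁻ u in Metric.ball x δ, ENNReal.ofReal (‖extendZero h u‖ ^ 2) ≤
      ∫⁻ z : Ball2, {x : Ball2 | ‖x.1‖ ≤ r}.indicator 1 z *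
        ENNReal.ofReal (‖h z‖ ^ 2) ∂eucMeasure := by
  have hsub : ∀ u ∈ Metric.ball x δ, ‖u‖ ≤ r := fun u hu => by
    have h1 := norm_sub_norm_le u x
    have h2 := mem_ball_iff_norm.1 hu
    linarith
  have heq : ∀ z : Ball2, {x : Ball2 | ‖x.1‖ ≤ r}.indicator 1 z * ENNReal.ofReal (‖h z‖ ^ 2) =
      ({x : E | ‖x‖ ≤ r}.indicator 1 z.1 * ENNReal.ofReal (‖extendZero h z.1‖ ^ 2) : ENNReal) :=
    fun z => by rw [extendZero_apply _ z.2]; rfl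
  simp only [heq]
  rw [lintegral_eucMeasure (fun x =>
    {x : E | ‖x‖ ≤ r}.indicator 1 x * ENNReal.ofReal (‖extendZero h x‖ ^ 2))]
  calc ∫⁻ u in Metric.ball x δ, ENNReal.ofReal (‖extendZero h u‖ ^ 2)
      = ∫⁻ u in Metric.ball x δ,
          {x : E | ‖x‖ ≤ r}.indicator 1 u * ENNReal.ofReal (‖extendZero h u‖ ^ 2) := by
        refine setLIntegral_congr_fun Metric.isOpen_ball.measurableSet fun u hu => ?_
        have : u ∈ {x : E | ‖x‖ ≤ r} := hsub u hu
        simp [this]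
    _ ≤ _ := lintegral_mono_set fun u hu => mem_ball_zero_iff.2 ((hsub u hu).trans_lt hr)

lemma norm_sq_mul_volume_le_eucMeasure {h : Ball2 → ℂ} (hh : IsHolomorphic h) {x : Ball2}
    {δ r : ℝ} (hxr : ‖x.1‖ + δ ≤ r) (hr : r < 1) :
    ENNReal.ofReal (‖h x‖ ^ 2) * volume (Metric.ball (0 : E) δ) ≤
      ∫⁻ z : Ball2, {x : Ball2 | ‖x.1‖ ≤ r}.indicator 1 z *
        ENNReal.ofReal (‖h z‖ ^ 2) ∂eucMeasure := by
  have h1 : DifferentiableOn ℂ (extendZero h) (Metric.ball x.1 δ) := by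
    refine DifferentiableOn.mono hh fun u hu => ?_
    have h1 := norm_sub_norm_le u x.1
    have h2 := mem_ball_iff_norm.1 hu
    rw [mem_ball_zero_iff]
    linarith
  have h2 := norm_sq_mul_volume_le h1
  rw [extendZero_apply _ x.2] at h2
  exact h2.trans (setLIntegral_ball_le_eucMeasure hxr hr h)

lemma measurableSet_norm_le (r : ℝ) : MeasurableSet {x : Ball2 | ‖x.1‖ ≤ r} :=
  (isClosed_le (by fun_prop) continuous_const).measurableSet

/-- The series of the squares of the Jacobians converges normally, locally on the ball. -/
lemma exists_summable_norm_jacobian_sq_le [DiscreteTopology Γ] (z : Ball2) :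
    ∃ r > 0, ∃ u : Γ → ℝ, Summable u ∧ (∀ γ, 0 ≤ u γ) ∧ Metric.ball z.1 r ⊆ Metric.ball 0 1 ∧
      ∀ γ : Γ, ∀ x : Ball2, x.1 ∈ Metric.ball z.1 r → ‖jacobian (γ : SU21) x‖ ^ 2 ≤ u γ := by
  have hz := mem_ball_zero_iff.1 z.2
  set δ := (1 - ‖z.1‖) / 3 with hδ
  have hδ0 : 0 < δ := by rw [hδ]; linarith
  set ρ := ‖z.1‖ + 2 * δ with hρ
  have hρ1 : ρ < 1 := by rw [hρ, hδ]; linarith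
  set S := {x : Ball2 | ‖x.1‖ ≤ ρ} with hS
  have hSm : MeasurableSet S := measurableSet_norm_le ρ
  obtain ⟨N, hN⟩ := exists_tsum_indicator_le Γ hρ1
  -- `I γ` is the Euclidean volume of `γ S`. The translates of `S` overlap at most `N` times, so the
  -- sum of these volumes is at most `N` times that of the ball; the sub-mean value property turns
  -- this into point-wise bounds.
  let I : Γ → ENNReal := fun γ => ∫⁻ x : Ball2, S.indicator 1 x *
    ENNReal.ofReal (‖jacobian (γ : SU21) x‖ ^ 2) ∂eucMeasure
  have hI : ∀ γ, I γ = ∫⁻ x : Ball2, S.indicator 1 (γ⁻¹ • x) ∂eucMeasure := fun γ => by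
    rw [← lintegral_smul_mul_jacobian (γ : SU21)]
    refine lintegral_congr fun x => ?_
    rw [mul_comm, show (γ : SU21) • x = γ • x from rfl, inv_smul_smul]
  have hItop : ∑' γ, I γ ≠ ⊤ := by
    simp only [hI]
    rw [← (Equiv.inv Γ).tsum_eq]
    simp only [Equiv.inv_apply, inv_inv]
    have hm : ∀ γ : Γ, Measurable fun x : Ball2 => (S.indicator 1 (γ • x) : ENNReal) := fun γ =>
      (measurable_one.indicator hSm).comp (measurable_const_smul γ)
    rw [← lintegral_tsum fun γ => (hm γ).aemeasurable]
    refine ne_top_of_le_ne_top ?_ (lintegral_mono hN)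
    rw [lintegral_const]
    exact ENNReal.mul_ne_top (ENNReal.natCast_ne_top N) (measure_ne_top _ _)
  set V := volume (Metric.ball (0 : E) δ) with hV
  have hV0 : V ≠ 0 := (Metric.measure_ball_pos volume _ hδ0).ne'
  have hVt : V ≠ ⊤ := measure_ball_lt_top.ne
  have hsum : ∑' γ, I γ / V ≠ ⊤ := by
    simp only [div_eq_mul_inv]
    rw [ENNReal.tsum_mul_right]
    exact ENNReal.mul_ne_top hItop (ENNReal.inv_ne_top.2 hV0)
  refine ⟨δ, hδ0, fun γ => (I γ / V).toReal, ENNReal.summable_toReal hsum,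
    fun γ => ENNReal.toReal_nonneg, fun x hx => ?_, fun γ x hx => ?_⟩
  · have h1 := norm_sub_norm_le x z.1
    have h2 := mem_ball_iff_norm.1 hx
    rw [mem_ball_zero_iff]
    linarith
  · have h1 := norm_sub_norm_le x.1 z.1
    have h2 := mem_ball_iff_norm.1 hx
    have h3 := norm_sq_mul_volume_le_eucMeasure (differentiableOn_extendZero_jacobian (γ : SU21))
      (x := x) (δ := δ) (r := ρ) (by linarith) hρ1
    have h4 : ENNReal.ofReal (‖jacobian (γ : SU21) x‖ ^ 2) ≤ I γ / V :=
      (ENNReal.le_div_iff_mul_le (Or.inl hV0) (Or.inl hVt)).2 h3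
    have h5 : I γ / V ≠ ⊤ := ENNReal.ne_top_of_tsum_ne_top hsum γ
    have h6 := ENNReal.toReal_mono h5 h4
    rwa [ENNReal.toReal_ofReal (by positivity)] at h6

/-- The Poincaré series of weight `k` attached to an element `g` of `SU((2,1), ℂ)`. -/
def poincareSeries (g : SU21) (k : ℕ) (w : Ball2) : ℂ :=
  ∑' γ : Γ, jacobian (g⁻¹ * γ) w ^ k

/-- The terms of a Poincaré series are dominated by a summable family, locally on the ball. -/
lemma exists_summable_poincare_le [DiscreteTopology Γ] (g : SU21) {k : ℕ} (hk : 2 ≤ k)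
    (z : Ball2) : ∃ r > 0, ∃ u : Γ → ℝ, Summable u ∧ Metric.ball z.1 r ⊆ Metric.ball 0 1 ∧
      ∀ γ : Γ, ∀ x : Ball2, x.1 ∈ Metric.ball z.1 r →
        ‖jacobian (g⁻¹ * γ) x ^ k‖ ≤ u γ := by
  obtain ⟨r, hr, u, hu, hu0, hball, hle⟩ := exists_summable_norm_jacobian_sq_le Γ z
  set C := 8 * ‖mat g 2 2‖ ^ 3
  have hC : 0 ≤ C := by positivity
  set M := Real.sqrt (∑' γ, u γ)
  -- Summability is known only for squares of Jacobians; the remaining `k - 2` factors are bounded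
  -- by the uniform constant `M`.
  refine ⟨r, hr, fun γ => C ^ k * M ^ (k - 2) * u γ, hu.mul_left _, hball, fun γ x hx => ?_⟩
  have h1 : ‖jacobian (γ : SU21) x‖ ≤ M :=
    Real.le_sqrt_of_sq_le ((hle γ x hx).trans (hu.le_tsum γ fun j _ => hu0 j))
  rw [norm_pow]
  calc ‖jacobian (g⁻¹ * γ) x‖ ^ k ≤ (C * ‖jacobian (γ : SU21) x‖) ^ k :=
        pow_le_pow_left₀ (norm_nonneg _) (norm_jacobian_inv_mul_le g γ x) k
    _ = C ^ k * (‖jacobian (γ : SU21) x‖ ^ (k - 2) * ‖jacobian (γ : SU21) x‖ ^ 2) := by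
        rw [mul_pow, ← pow_add, Nat.sub_add_cancel hk]
    _ ≤ C ^ k * (M ^ (k - 2) * u γ) := by
        gcongr
        exact hle γ x hx
    _ = _ := by ring

/-- Automorphy comes from reindexing by right translation together with the cocycle identity;
holomorphy comes from normal convergence. -/
lemma poincareSeries_mem [DiscreteTopology Γ] (g : SU21) {k : ℕ} (hk : 2 ≤ k) :
    poincareSeries Γ g k ∈ H0 Γ k := by
  refine ⟨fun z hz => ?_, fun γ' hγ' z => ?_⟩
  · obtain ⟨r, hr, u, hu, hball, hle⟩ := exists_summable_poincare_le Γ g hk ⟨z, hz⟩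
    have h := differentiableAt_tsum_of_summable_norm (z := z)
      (f := fun (γ : Γ) x => extendZero (jacobian (g⁻¹ * γ)) x ^ k) hr hu
      (fun γ x hx => ((differentiableOn_extendZero_jacobian (g⁻¹ * γ)).differentiableAt
        (Metric.isOpen_ball.mem_nhds (hball hx))).pow k)
      (fun γ x hx => by
        simpa only [extendZero_apply _ (hball hx)] using hle γ ⟨x, hball hx⟩ hx)
    refine (h.congr_of_eventuallyEq ?_).differentiableWithinAt
    filter_upwards [Metric.isOpen_ball.mem_nhds hz] with x hx
    simp only [extendZero_apply _ hx, poincareSeries]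
  · rw [poincareSeries, poincareSeries, ← tsum_mul_right,
      ← (Equiv.mulRight (⟨γ', hγ'⟩ : Γ)).tsum_eq fun γ : Γ => jacobian (g⁻¹ * γ) z ^ k]
    refine tsum_congr fun γ => ?_
    rw [← mul_pow, ← jacobian_mul, mul_assoc]
    rfl

end Poincare

/-! ### A criterion for finite dimension in an inner product space. -/

section Abstract

/-- If the orthonormal families of an inner product space have bounded cardinality, then the space
has a finite orthonormal basis. -/
lemma exists_orthonormal_span_eq_top {V : Type*} [AddCommGroup V] [Module ℂ V]
    (c : InnerProductSpace.Core ℂ V) (n : ℕ)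
    (hn : ∀ (m : ℕ) (v : Fin m → V),
      (∀ i j, c.inner (v i) (v j) = if i = j then 1 else 0) → m ≤ n) :
    ∃ (d : ℕ) (v : Fin d → V), (∀ i j, c.inner (v i) (v j) = if i = j then 1 else 0) ∧
      Submodule.span ℂ (Set.range v) = ⊤ := by
  let _ : NormedAddCommGroup V := c.toNormedAddCommGroup
  let _ : InnerProductSpace ℂ V := InnerProductSpace.ofCore c.toCore
  have horth : ∀ (m : ℕ) (v : Fin m → V), Orthonormal ℂ v → m ≤ n := fun m v hv =>
    hn m v (orthonormal_iff_ite.1 hv)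
  -- A finite independent set spans a subspace of dimension its cardinality, which has an
  -- orthonormal basis of that size.
  have hrank : Module.rank ℂ V ≤ n := by
    refine rank_le fun s hs => ?_
    have h1 : Module.finrank ℂ (Submodule.span ℂ (s : Set V)) = s.card := by
      rw [← Fintype.card_coe s, ← finrank_span_eq_card hs, Subtype.range_coe_subtype]
      rfl
    have hb := (stdOrthonormalBasis ℂ (Submodule.span ℂ (s : Set V))).orthonormal
    rw [← h1]
    exact horth _ _ (hb.comp_linearIsometry (Submodule.span ℂ (s : Set V)).subtypeₗᵢ)
  have : FiniteDimensional ℂ V :=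
    Module.rank_lt_aleph0_iff.1 (hrank.trans_lt (Cardinal.natCast_lt_aleph0))
  refine ⟨_, stdOrthonormalBasis ℂ V,
    orthonormal_iff_ite.1 (stdOrthonormalBasis ℂ V).orthonormal, ?_⟩
  have h := (stdOrthonormalBasis ℂ V).toBasis.span_eq
  rwa [OrthonormalBasis.coe_toBasis] at h

end Abstract

/-! ### The `L²` structure on sections and existence of finite orthonormal bases. -/

section Sections

variable {Γ : Subgroup SU21} {k : ℕ}

/-- The square of the point-wise norm of a section. -/
def normSq (k : ℕ) (f : Ball2 → ℂ) (z : Ball2) : ℝ := wt z ^ (3 * k) * ‖f z‖ ^ 2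

lemma normSq_nonneg (k : ℕ) (f : Ball2 → ℂ) (z : Ball2) : 0 ≤ normSq k f z :=
  mul_nonneg (pow_nonneg (wt_pos z).le _) (sq_nonneg _)

lemma normSq_slash (g : SU21) (f : Ball2 → ℂ) (z : Ball2) :
    normSq k (fun w => f (g • w) * jacobian g w ^ k) z = normSq k f (g • z) := by
  rw [normSq, normSq, pow_mul, pow_mul, wt_smul_pow_three, norm_mul, norm_pow]
  ring

lemma normSq_smul {f : Ball2 → ℂ} (hf : f ∈ H0 Γ k) (γ : Γ) (z : Ball2) :
    normSq k f (γ • z) = normSq k f z := by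
  rw [show γ • z = (γ : SU21) • z from rfl, ← normSq_slash]
  simp only [normSq, hf.2 γ.1 γ.2]

lemma continuous_of_mem {f : Ball2 → ℂ} (hf : f ∈ H0 Γ k) : Continuous f :=
  IsHolomorphic.continuous hf.1

lemma measurable_ofReal_normSq {f : Ball2 → ℂ} (hf : f ∈ H0 Γ k) :
    Measurable fun z => ENNReal.ofReal (normSq k f z) :=
  ENNReal.measurable_ofReal.comp
    ((continuous_wt.pow _).mul ((continuous_of_mem hf).norm.pow 2)).measurable

lemma continuous_normSq {f : Ball2 → ℂ} (hf : f ∈ H0 Γ k) : Continuous (normSq k f) :=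
  (continuous_wt.pow _).mul ((continuous_of_mem hf).norm.pow 2)

lemma innerHyp_self (F : Set Ball2) (k : ℕ) {f : Ball2 → ℂ} (hf : f ∈ H0 Γ k) :
    innerHyp F k f f =
      ((∫⁻ z in F, ENNReal.ofReal (normSq k f z) ∂hypMeasure).toReal : ℂ) := by
  have h : ∀ z : Ball2, (((1 - ‖z.1‖ ^ 2) ^ (3 * k) : ℝ) : ℂ) * f z * starRingEnd ℂ (f z) =
      ((normSq k f z : ℝ) : ℂ) := fun z => by
    rw [mul_assoc, Complex.mul_conj, Complex.normSq_eq_norm_sq, normSq, wt]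
    push_cast
    rfl
  rw [innerHyp]
  simp only [h]
  rw [integral_complex_ofReal, integral_eq_lintegral_of_nonneg_ae
    (Eventually.of_forall fun z => normSq_nonneg k f z)
    (continuous_normSq hf).aestronglyMeasurable]

variable {F : Set Ball2}

/-- The point-wise norm is continuous and invariant, and a compact ball meets every orbit. -/
lemma exists_normSq_le [CompactSpace (PicardSurface Γ)] {f : Ball2 → ℂ} (hf : f ∈ H0 Γ k) : ∃ M, ∀ z, normSq k f z ≤ M := by
  obtain ⟨r, hr0, hr1, hr⟩ := exists_smul_norm_le Γ
  have hK : IsCompact {x : Ball2 | ‖x.1‖ ≤ r} := by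
    have h1 : IsCompact (Metric.closedBall (0 : E) r) := isCompact_closedBall _ _
    refine (Subtype.isCompact_iff).2 ?_
    convert h1 using 1
    ext x
    constructor
    · rintro ⟨y, hy, rfl⟩
      exact mem_closedBall_zero_iff.2 hy
    · intro hx
      have hx' := mem_closedBall_zero_iff.1 hx
      exact ⟨⟨x, mem_ball_zero_iff.2 (hx'.trans_lt hr1)⟩, hx', rfl⟩
  obtain ⟨M, hM⟩ := hK.exists_bound_of_continuousOn (continuous_normSq hf).continuousOn
  refine ⟨M, fun z => ?_⟩
  obtain ⟨γ, hγ⟩ := hr z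
  rw [← normSq_smul hf γ]
  exact (le_abs_self _).trans (hM _ hγ)

variable [DiscreteTopology Γ]

/-- The integral of an invariant function over a relatively compact ball is bounded by a multiple
of its integral over a fundamental domain. -/
lemma exists_lintegral_indicator_mul_le (hF : IsFundamentalDomain Γ F hypMeasure) {r : ℝ}
    (hr : r < 1) : ∃ N : ℕ, ∀ φ : Ball2 → ENNReal, Measurable φ →
      (∀ (γ : Γ) (z : Ball2), φ (γ • z) = φ z) →
      ∫⁻ z, {x : Ball2 | ‖x.1‖ ≤ r}.indicator 1 z * φ z ∂hypMeasure ≤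
        N * ∫⁻ z in F, φ z ∂hypMeasure := by
  obtain ⟨N, hN⟩ := exists_tsum_indicator_le Γ hr
  refine ⟨N, fun φ hφ hinv => ?_⟩
  set S := {x : Ball2 | ‖x.1‖ ≤ r}
  have hm : ∀ γ : Γ, Measurable fun x : Ball2 => (S.indicator 1 (γ • x) : ENNReal) := fun γ =>
    (measurable_one.indicator (measurableSet_norm_le r)).comp (measurable_const_smul γ)
  -- Unfolding over `F`: by invariance of `φ` the sum over `Γ` only counts how often the orbit of a
  -- point meets `S`.
  rw [hF.lintegral_eq_tsum'']
  simp only [hinv]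
  have hm' : ∀ γ : Γ, Measurable fun x : Ball2 => (S.indicator 1 (γ • x) * φ x : ENNReal) :=
    fun γ => (hm γ).mul hφ
  rw [← lintegral_tsum fun γ => (hm' γ).aemeasurable, ← lintegral_const_mul _ hφ]
  refine lintegral_mono fun z => ?_
  simp only
  rw [ENNReal.tsum_mul_right]
  exact mul_le_mul_left (hN z) _

lemma wt_ge {r : ℝ} {z : Ball2} (hz : ‖z.1‖ ≤ r) : 1 - r ^ 2 ≤ wt z := by
  rw [wt]
  nlinarith [norm_nonneg z.1]

/-- `F` need not be relatively compact. Unfolding the finite volume of a compact ball that meets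
every orbit shows that it dominates the volume of `F`. -/
lemma hypMeasure_fundamentalDomain_ne_top [CompactSpace (PicardSurface Γ)]
    (hF : IsFundamentalDomain Γ F hypMeasure) : hypMeasure F ≠ ⊤ := by
  obtain ⟨r, hr0, hr1, hr⟩ := exists_smul_norm_le Γ
  set S := {x : Ball2 | ‖x.1‖ ≤ r} with hS
  have hSm : MeasurableSet S := measurableSet_norm_le r
  have hSfin : hypMeasure S ≠ ⊤ := by
    rw [← lintegral_indicator_one hSm, lintegral_hypMeasure]
    have hc : 0 < 1 - r ^ 2 := by nlinarith
    refine ne_top_of_le_ne_top (b := ENNReal.ofReal (((1 - r ^ 2) ^ 3)⁻¹) *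
      eucMeasure Set.univ) (ENNReal.mul_ne_top ENNReal.ofReal_ne_top (measure_ne_top _ _)) ?_
    rw [← lintegral_const]
    refine lintegral_mono fun z => ?_
    by_cases hz : z ∈ S
    · rw [Set.indicator_of_mem hz, Pi.one_apply, mul_one]
      refine ENNReal.ofReal_le_ofReal ?_
      have := wt_ge hz
      gcongr
    · rw [Set.indicator_of_notMem hz, mul_zero]
      exact zero_le
  refine ne_top_of_le_ne_top hSfin ?_
  have hm : ∀ γ : Γ, Measurable fun x : Ball2 => (S.indicator 1 (γ • x) : ENNReal) := fun γ =>
    (measurable_one.indicator hSm).comp (measurable_const_smul γ)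
  rw [← lintegral_indicator_one hSm, hF.lintegral_eq_tsum'',
    ← lintegral_tsum fun γ => (hm γ).aemeasurable, ← setLIntegral_one]
  refine lintegral_mono fun z => ?_
  obtain ⟨γ, hγ⟩ := hr z
  refine le_trans ?_ (ENNReal.le_tsum γ)
  have : γ • z ∈ S := hγ
  rw [Set.indicator_of_mem this]
  rfl

variable [CompactSpace (PicardSurface Γ)]

/-- The point-wise norm of a section is bounded by a multiple of its `L²` norm. -/
lemma exists_ofReal_normSq_le (hF : IsFundamentalDomain Γ F hypMeasure) (k : ℕ) :
    ∃ C : ENNReal, C ≠ ⊤ ∧ ∀ f ∈ H0 Γ k, ∀ z,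
      ENNReal.ofReal (normSq k f z) ≤
        C * ∫⁻ w in F, ENNReal.ofReal (normSq k f w) ∂hypMeasure := by
  obtain ⟨r, hr0, hr1, hr⟩ := exists_smul_norm_le Γ
  set δ := (1 - r) / 2 with hδ
  have hδ0 : 0 < δ := by rw [hδ]; linarith
  have hρ1 : r + δ < 1 := by rw [hδ]; linarith
  set ρ := r + δ with hρ
  set S := {x : Ball2 | ‖x.1‖ ≤ ρ} with hS
  obtain ⟨N, hN⟩ := exists_lintegral_indicator_mul_le hF hρ1
  set V := volume (Metric.ball (0 : E) δ) with hV
  have hV0 : V ≠ 0 := (Metric.measure_ball_pos volume _ hδ0).ne'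
  have hVt : V ≠ ⊤ := measure_ball_lt_top.ne
  have hc : 0 < 1 - ρ ^ 2 := by nlinarith
  -- On the ball of radius `ρ` the weight is at least `c⁻¹`, so `c` compares the flat `L²` norm in
  -- the sub-mean value property with the weighted one.
  set c := ((1 - ρ ^ 2) ^ (3 * k))⁻¹ with hcdef
  have hc0 : 0 ≤ c := by positivity
  refine ⟨ENNReal.ofReal c * N / V, ENNReal.div_ne_top
    (ENNReal.mul_ne_top ENNReal.ofReal_ne_top (ENNReal.natCast_ne_top N)) hV0,
    fun f hf z => ?_⟩
  obtain ⟨γ, hγ⟩ := hr z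
  rw [← normSq_smul hf γ]
  set x := γ • z
  have h1 : normSq k f x ≤ ‖f x‖ ^ 2 := by
    rw [normSq]
    exact mul_le_of_le_one_left (sq_nonneg _) (pow_le_one₀ (wt_pos x).le (wt_le_one x))
  have h2 := norm_sq_mul_volume_le_eucMeasure hf.1 (x := x) (δ := δ) (r := ρ)
    (by linarith) hρ1
  have h3 : ∫⁻ z : Ball2, S.indicator 1 z * ENNReal.ofReal (‖f z‖ ^ 2) ∂eucMeasure ≤
      ∫⁻ z, ENNReal.ofReal c * (S.indicator 1 z * ENNReal.ofReal (normSq k f z))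
        ∂hypMeasure := by
    rw [lintegral_hypMeasure]
    refine lintegral_mono fun w => ?_
    by_cases hw : w ∈ S
    · simp only [Set.indicator_of_mem hw, Pi.one_apply, one_mul]
      rw [← ENNReal.ofReal_mul hc0, ← ENNReal.ofReal_mul (inv_nonneg.2
        (pow_nonneg (wt_pos w).le 3))]
      refine ENNReal.ofReal_le_ofReal ?_
      have hw1 := wt_ge hw
      have hw0 := wt_pos w
      have ha : 1 ≤ (wt w ^ 3)⁻¹ := (one_le_inv₀ (by positivity)).2
        (pow_le_one₀ hw0.le (wt_le_one w))
      have hb : 1 ≤ c * wt w ^ (3 * k) := by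
        rw [hcdef, inv_mul_eq_div, one_le_div (by positivity)]
        exact pow_le_pow_left₀ hc.le hw1 _
      calc ‖f w‖ ^ 2 ≤ (wt w ^ 3)⁻¹ * (c * wt w ^ (3 * k)) * ‖f w‖ ^ 2 :=
            le_mul_of_one_le_left (sq_nonneg _) (one_le_mul_of_one_le_of_one_le ha hb)
        _ = _ := by rw [normSq]; ring
    · simp [Set.indicator_of_notMem hw]
  have hm := measurable_ofReal_normSq hf
  have hm' : Measurable fun z => (S.indicator 1 z * ENNReal.ofReal (normSq k f z) : ENNReal) :=
    (measurable_one.indicator (measurableSet_norm_le ρ)).mul hm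
  rw [lintegral_const_mul _ hm'] at h3
  have h4 := hN (fun z => ENNReal.ofReal (normSq k f z)) hm
    (fun γ z => by rw [normSq_smul hf])
  calc ENNReal.ofReal (normSq k f x) ≤ ENNReal.ofReal (‖f x‖ ^ 2) :=
        ENNReal.ofReal_le_ofReal h1
    _ ≤ ENNReal.ofReal c * (N * ∫⁻ w in F, ENNReal.ofReal (normSq k f w) ∂hypMeasure) / V :=
        (ENNReal.le_div_iff_mul_le (Or.inl hV0) (Or.inl hVt)).2
          (h2.trans (h3.trans (mul_le_mul_right h4 _)))
    _ = _ := by simp only [div_eq_mul_inv]; ring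

lemma integrableOn_inner (hF : IsFundamentalDomain Γ F hypMeasure) {f g : Ball2 → ℂ}
    (hf : f ∈ H0 Γ k) (hg : g ∈ H0 Γ k) :
    IntegrableOn (fun z : Ball2 => (((1 - ‖z.1‖ ^ 2) ^ (3 * k) : ℝ) : ℂ) * f z *
      starRingEnd ℂ (g z)) F hypMeasure := by
  obtain ⟨M, hM⟩ := exists_normSq_le hf
  obtain ⟨M', hM'⟩ := exists_normSq_le hg
  have hfin : IsFiniteMeasure (hypMeasure.restrict F) :=
    ⟨by rw [Measure.restrict_apply_univ]
        exact (hypMeasure_fundamentalDomain_ne_top hF).lt_top⟩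
  refine Integrable.of_bound (C := (M + M') / 2) ?_ (Eventually.of_forall fun z => ?_)
  · refine Continuous.aestronglyMeasurable ?_
    exact ((Complex.continuous_ofReal.comp (continuous_wt.pow _)).mul (continuous_of_mem hf)).mul
      (Complex.continuous_conj.comp (continuous_of_mem hg))
  · have h1 := hM z
    have h2 := hM' z
    have hw : 0 ≤ wt z ^ (3 * k) := pow_nonneg (wt_pos z).le _
    rw [norm_mul, norm_mul, RCLike.norm_conj, Complex.norm_real,
      show (1 - ‖z.1‖ ^ 2) = wt z from rfl, Real.norm_of_nonneg hw]
    rw [normSq] at h1 h2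
    nlinarith [mul_nonneg hw (sq_nonneg (‖f z‖ - ‖g z‖))]

lemma lintegral_normSq_ne_top (hF : IsFundamentalDomain Γ F hypMeasure) {f : Ball2 → ℂ}
    (hf : f ∈ H0 Γ k) : ∫⁻ z in F, ENNReal.ofReal (normSq k f z) ∂hypMeasure ≠ ⊤ := by
  obtain ⟨M, hM⟩ := exists_normSq_le hf
  refine ne_top_of_le_ne_top (b := ENNReal.ofReal M * hypMeasure F) (ENNReal.mul_ne_top
    ENNReal.ofReal_ne_top (hypMeasure_fundamentalDomain_ne_top hF)) ?_
  rw [← setLIntegral_const]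
  exact lintegral_mono fun z => ENNReal.ofReal_le_ofReal (hM z)

lemma exists_normSq_le_innerHyp (hF : IsFundamentalDomain Γ F hypMeasure) (k : ℕ) :
    ∃ C : ℝ, 0 ≤ C ∧ ∀ f ∈ H0 Γ k, ∀ z, normSq k f z ≤ C * (innerHyp F k f f).re := by
  obtain ⟨C, hC, h⟩ := exists_ofReal_normSq_le hF k
  refine ⟨C.toReal, ENNReal.toReal_nonneg, fun f hf z => ?_⟩
  have h1 := ENNReal.toReal_mono (ENNReal.mul_ne_top hC (lintegral_normSq_ne_top hF hf)) (h f hf z)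
  rw [ENNReal.toReal_ofReal (normSq_nonneg _ _ _), ENNReal.toReal_mul] at h1
  rwa [innerHyp_self F k hf, Complex.ofReal_re]

lemma innerHyp_add_left (hF : IsFundamentalDomain Γ F hypMeasure) {f g h : Ball2 → ℂ}
    (hf : f ∈ H0 Γ k) (hg : g ∈ H0 Γ k) (hh : h ∈ H0 Γ k) :
    innerHyp F k (f + g) h = innerHyp F k f h + innerHyp F k g h := by
  rw [innerHyp, innerHyp, innerHyp,
    ← integral_add (integrableOn_inner hF hf hh) (integrableOn_inner hF hg hh)]
  refine integral_congr_ae (Eventually.of_forall fun z => ?_)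
  simp only [Pi.add_apply]
  ring

lemma innerHyp_smul_left (F : Set Ball2) (k : ℕ) (c : ℂ) (f h : Ball2 → ℂ) :
    innerHyp F k (c • f) h = c * innerHyp F k f h := by
  rw [innerHyp, innerHyp, ← integral_const_mul]
  refine integral_congr_ae (Eventually.of_forall fun z => ?_)
  simp only [Pi.smul_apply, smul_eq_mul]
  ring

lemma conj_innerHyp (F : Set Ball2) (k : ℕ) (f h : Ball2 → ℂ) :
    starRingEnd ℂ (innerHyp F k f h) = innerHyp F k h f := by
  rw [innerHyp, innerHyp, ← integral_conj]
  refine integral_congr_ae (Eventually.of_forall fun z => ?_)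
  simp only [map_mul, Complex.conj_ofReal, Complex.conj_conj]
  ring

/-- The `L²` inner product on the space of sections. -/
@[reducible]
def innerCore (hF : IsFundamentalDomain Γ F hypMeasure) (k : ℕ) :
    InnerProductSpace.Core ℂ (H0 Γ k) where
  -- The arguments are swapped because `innerHyp` is linear in its first argument, while
  -- `InnerProductSpace.Core` requires conjugate-linearity there.
  inner f g := innerHyp F k (g : Ball2 → ℂ) f
  conj_inner_symm f g := conj_innerHyp F k f g
  re_inner_nonneg f := by
    rw [innerHyp_self F k f.2]
    exact ENNReal.toReal_nonneg
  add_left f g h := by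
    rw [← conj_innerHyp F k (f + g : H0 Γ k), ← conj_innerHyp F k (f : Ball2 → ℂ),
      ← conj_innerHyp F k (g : Ball2 → ℂ), Submodule.coe_add, innerHyp_add_left hF f.2 g.2 h.2,
      map_add]
  smul_left f g c := by
    rw [← conj_innerHyp F k (c • f : H0 Γ k), ← conj_innerHyp F k (f : Ball2 → ℂ),
      Submodule.coe_smul, innerHyp_smul_left, map_mul]
  definite f hf := by
    obtain ⟨C, _, hC⟩ := exists_normSq_le_innerHyp hF k
    refine Subtype.ext (funext fun z => ?_)
    have h1 := hC f f.2 z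
    rw [show innerHyp F k (f : Ball2 → ℂ) f = 0 from hf, Complex.zero_re, mul_zero, normSq] at h1
    have h2 : ‖(f : Ball2 → ℂ) z‖ ^ 2 ≤ 0 := by
      by_contra hlt
      push Not at hlt
      exact absurd h1 (not_le.2 (mul_pos (pow_pos (wt_pos z) _) hlt))
    have h3 := pow_eq_zero_iff (two_ne_zero) |>.1 (le_antisymm h2 (sq_nonneg _))
    exact norm_eq_zero.1 h3

lemma innerHyp_sum_left (hF : IsFundamentalDomain Γ F hypMeasure) {n : ℕ} (c : Fin n → ℂ)
    (v : Fin n → H0 Γ k) (h : H0 Γ k) :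
    innerHyp F k ((∑ i, c i • v i : H0 Γ k) : Ball2 → ℂ) h =
      ∑ i, c i * innerHyp F k (v i) h := by
  let L : H0 Γ k →ₗ[ℂ] ℂ :=
    { toFun := fun f => innerHyp F k f h
      map_add' := fun f g => innerHyp_add_left hF f.2 g.2 h.2
      map_smul' := fun c f => innerHyp_smul_left F k c f h }
  change L (∑ i, c i • v i) = _
  simp [map_sum, L]

/-- The diagonal of the kernel of an orthonormal family of sections. -/
lemma exists_sum_normSq_le (hF : IsFundamentalDomain Γ F hypMeasure) (k : ℕ) :
    ∃ C : ℝ, 0 ≤ C ∧ ∀ (n : ℕ) (v : Fin n → H0 Γ k),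
      (∀ i j, innerHyp F k (v i) (v j) = if i = j then 1 else 0) →
      ∀ z, ∑ i, normSq k (v i) z ≤ C := by
  obtain ⟨C, hC0, hC⟩ := exists_normSq_le_innerHyp hF k
  refine ⟨C, hC0, fun n v hv z => ?_⟩
  set T := ∑ i, ‖(v i : Ball2 → ℂ) z‖ ^ 2 with hT
  have hT0 : 0 ≤ T := Finset.sum_nonneg fun i _ => sq_nonneg _
  -- The section representing evaluation at `z` on the span of the family: both `f z` and `⟨f, f⟩`
  -- equal `T`, so the sup bound reads `wt^{3k} T² ≤ C T`.
  let f : H0 Γ k := ∑ i, starRingEnd ℂ ((v i : Ball2 → ℂ) z) • v i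
  have hfz : (f : Ball2 → ℂ) z = (T : ℂ) := by
    simp only [f, Submodule.coe_sum, Submodule.coe_smul, Finset.sum_apply, Pi.smul_apply,
      smul_eq_mul, hT, Complex.ofReal_sum]
    refine Finset.sum_congr rfl fun i _ => ?_
    rw [Complex.conj_mul']
    push_cast
    rfl
  have hvf : ∀ i, innerHyp F k (v i) f = (v i : Ball2 → ℂ) z := fun i => by
    rw [← conj_innerHyp, innerHyp_sum_left hF]
    simp [hv]
  have hff : innerHyp F k f f = (T : ℂ) := by
    rw [innerHyp_sum_left hF]
    simp only [hvf, hT, Complex.ofReal_sum]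
    refine Finset.sum_congr rfl fun i _ => ?_
    rw [Complex.conj_mul']
    push_cast
    rfl
  have h1 := hC f f.2 z
  rw [hff, Complex.ofReal_re, normSq, hfz, Complex.norm_real, Real.norm_of_nonneg hT0] at h1
  have h2 : ∑ i, normSq k (v i) z = wt z ^ (3 * k) * T := by
    rw [hT, Finset.mul_sum]
    rfl
  rw [h2]
  rcases hT0.eq_or_lt with h0 | h0
  · rw [← h0, mul_zero]; exact hC0
  · refine le_of_mul_le_mul_right ?_ h0
    linarith

/-- Integrating the uniform bound `∑ |v_i|² ≤ C` over `F` bounds the size of any orthonormal family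
by `C vol(F)`. -/
lemma exists_isOrthonormalBasis (hF : IsFundamentalDomain Γ F hypMeasure) (k : ℕ) :
    ∃ (d : ℕ) (ω : Fin d → H0 Γ k), IsOrthonormalBasis Γ F k ω := by
  obtain ⟨C, hC0, hC⟩ := exists_sum_normSq_le hF k
  have hfin := hypMeasure_fundamentalDomain_ne_top hF
  obtain ⟨d, v, hv, hspan⟩ := exists_orthonormal_span_eq_top (innerCore hF k)
    ⌊C * (hypMeasure F).toReal⌋₊ (fun m v hv => by
      have hv' : ∀ i j, innerHyp F k (v i) (v j) = if i = j then 1 else 0 := fun i j => by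
        rw [show innerHyp F k (v i) (v j) = _ from hv j i]
        simp only [eq_comm]
      refine Nat.le_floor ?_
      have h1 : ∀ i, ∫⁻ z in F, ENNReal.ofReal (normSq k (v i) z) ∂hypMeasure = 1 := fun i => by
        have h2 := innerHyp_self F k (v i).2
        rw [hv', if_pos rfl] at h2
        have h3 := Complex.ofReal_injective (h2.symm.trans Complex.ofReal_one.symm)
        rw [← ENNReal.ofReal_toReal (lintegral_normSq_ne_top hF (v i).2), h3,
          ENNReal.ofReal_one]
      have h2 : (m : ENNReal) ≤ ENNReal.ofReal C * hypMeasure F := by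
        calc (m : ENNReal)
            = ∑ i : Fin m, ∫⁻ z in F, ENNReal.ofReal (normSq k (v i) z) ∂hypMeasure := by
              simp [h1]
          _ = ∫⁻ z in F, ∑ i : Fin m, ENNReal.ofReal (normSq k (v i) z) ∂hypMeasure := by
              rw [lintegral_finsetSum _ fun i _ => measurable_ofReal_normSq (v i).2]
          _ ≤ ∫⁻ z in F, ENNReal.ofReal C ∂hypMeasure := by
              refine lintegral_mono fun z => ?_
              rw [← ENNReal.ofReal_sum_of_nonneg fun i _ => normSq_nonneg _ _ _]
              exact ENNReal.ofReal_le_ofReal (hC m v hv' z)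
          _ = _ := setLIntegral_const _ _
      have h3 := ENNReal.toReal_mono (ENNReal.mul_ne_top ENNReal.ofReal_ne_top hfin) h2
      rwa [ENNReal.toReal_natCast, ENNReal.toReal_mul, ENNReal.toReal_ofReal hC0] at h3)
  refine ⟨d, v, fun i j => ?_, hspan⟩
  rw [show innerHyp F k (v i) (v j) = _ from hv j i]
  simp only [eq_comm]

end Sections

/-! ### The reproducing property and bounds for the Bergman kernel on the diagonal. -/

section Reproducing

/-- The center of the ball. -/
def origin : Ball2 := ⟨0, Metric.mem_ball_self one_pos⟩

/-- The integral of the weight `(1 - |z|²)^{3k}` with respect to the hyperbolic volume. -/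
def weightIntegral (k : ℕ) : ℝ := ∫ z : Ball2, wt z ^ (3 * k - 3) ∂eucMeasure

lemma eucMeasure_univ_ne_zero : eucMeasure Set.univ ≠ 0 := by
  rw [eucMeasure, comap_subtype_coe_apply measurableSet_ball, Set.image_univ,
    Subtype.range_coe_subtype]
  exact (Metric.measure_ball_pos volume (0 : E) one_pos).ne'

lemma weightIntegral_pos (k : ℕ) : 0 < weightIntegral k := by
  have : NeZero eucMeasure := ⟨fun h => eucMeasure_univ_ne_zero (by rw [h]; rfl)⟩
  refine (integral_pos_iff_support_of_nonneg (fun z => pow_nonneg (wt_pos z).le _) ?_).2 ?_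
  · refine Integrable.of_bound (C := 1) (continuous_wt.pow _).aestronglyMeasurable
      (Eventually.of_forall fun z => ?_)
    rw [Real.norm_of_nonneg (pow_nonneg (wt_pos z).le _)]
    exact pow_le_one₀ (wt_pos z).le (wt_le_one z)
  · rw [show Function.support (fun z : Ball2 => wt z ^ (3 * k - 3)) = Set.univ from
      Set.eq_univ_of_forall fun z => (pow_pos (wt_pos z) _).ne']
    exact pos_iff_ne_zero.2 eucMeasure_univ_ne_zero

/-- For `k ≥ 2` one has `2(3k - 3) ≥ 3k`, so the left side has square at most `M`, and `t ≤ t² + 1`.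
-/
lemma pow_mul_norm_le {k : ℕ} (hk : 2 ≤ k) {f : Ball2 → ℂ} {M : ℝ} {z : Ball2}
    (hM : normSq k f z ≤ M) : wt z ^ (3 * k - 3) * ‖f z‖ ≤ M + 1 := by
  have h0 := wt_pos z
  have h1 : (wt z ^ (3 * k - 3)) ^ 2 ≤ wt z ^ (3 * k) := by
    rw [← pow_mul]
    exact pow_le_pow_of_le_one h0.le (wt_le_one z) (by omega)
  rw [normSq] at hM
  have h2 : (wt z ^ (3 * k - 3) * ‖f z‖) ^ 2 ≤ M := by
    rw [mul_pow]
    exact (mul_le_mul_of_nonneg_right h1 (sq_nonneg _)).trans hM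
  nlinarith [sq_nonneg (wt z ^ (3 * k - 3) * ‖f z‖ - 1)]

lemma pow_sub_mul_pow {k : ℕ} (hk : 2 ≤ k) (z : Ball2) :
    wt z ^ (3 * k) = wt z ^ 3 * wt z ^ (3 * k - 3) := by
  rw [← pow_add]
  congr 1
  omega

/-- The mean value property of sections at the center of the ball. -/
lemma integral_pow_mul {k : ℕ} (hk : 2 ≤ k) {f : Ball2 → ℂ} (hf : IsHolomorphic f) {M : ℝ}
    (hM : ∀ z, normSq k f z ≤ M) :
    ∫ z, ((wt z ^ (3 * k) : ℝ) : ℂ) * f z ∂hypMeasure = f origin * weightIntegral k := by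
  -- The hyperbolic density removes three powers and leaves a radial weight.
  let ρ : E → ℝ := fun x => (1 - ‖x‖ ^ 2) ^ (3 * k - 3)
  have hρ : ContinuousOn ρ (Metric.ball 0 1) := by
    refine Continuous.continuousOn ?_
    fun_prop
  have hint : IntegrableOn (fun u => (ρ u : ℂ) * extendZero f u) (Metric.ball 0 1) := by
    have hfin : IsFiniteMeasure (volume.restrict (Metric.ball (0 : E) 1)) :=
      ⟨by rw [Measure.restrict_apply_univ]; exact measure_ball_lt_top⟩
    refine Integrable.of_bound (C := M + 1) ?_ ?_
    · exact ((Complex.continuous_ofReal.comp_continuousOn hρ).mul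
        hf.continuousOn).aestronglyMeasurable measurableSet_ball
    · refine (ae_restrict_mem measurableSet_ball).mono fun u hu => ?_
      rw [extendZero_apply _ hu, norm_mul, Complex.norm_real,
        show ρ u = wt ⟨u, hu⟩ ^ (3 * k - 3) from rfl,
        Real.norm_of_nonneg (pow_nonneg (wt_pos ⟨u, hu⟩).le (3 * k - 3))]
      exact pow_mul_norm_le hk (hM ⟨u, hu⟩)
  have h := setIntegral_weight_mul hf hρ (fun c hc u => by simp [ρ, norm_smul, hc]) hint
  rw [show extendZero f 0 = f origin from extendZero_apply _ origin.2, ← integral_eucMeasure, ← integral_eucMeasure] at h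
  have h2 : ∫ z : Ball2, (ρ z.1 : ℂ) ∂eucMeasure = (weightIntegral k : ℂ) :=
    integral_complex_ofReal
  rw [h2] at h
  rw [integral_hypMeasure]
  refine Eq.trans (integral_congr_ae (Eventually.of_forall fun z => ?_)) h
  have h0 : ((wt z : ℝ) : ℂ) ≠ 0 := Complex.ofReal_ne_zero.2 (wt_pos z).ne'
  simp only [extendZero_apply _ z.2, pow_sub_mul_pow hk]
  rw [show ρ z.1 = wt z ^ (3 * k - 3) from rfl]
  push_cast
  field_simp

lemma isHolomorphic_slash {f : Ball2 → ℂ} (hf : IsHolomorphic f) (g : SU21) (k : ℕ) :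
    IsHolomorphic fun w => f (g • w) * jacobian g w ^ k := by
  have h1 : DifferentiableOn ℂ (fun x => extendZero f (moebius (mat g) x) *
      extendZero (jacobian g) x ^ k) (Metric.ball 0 1) := by
    refine DifferentiableOn.mul ?_ ((differentiableOn_extendZero_jacobian g).pow k)
    exact hf.comp (fun x hx => (differentiableAt_moebius g hx).differentiableWithinAt)
      fun x hx => moebius_mem_ball g ⟨x, hx⟩
  refine h1.congr fun x hx => ?_
  rw [extendZero_apply _ hx, extendZero_apply _ hx,
    extendZero_apply _ (moebius_mem_ball g ⟨x, hx⟩)]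
  rfl

lemma integrable_hypMeasure_of_norm_le {φ : Ball2 → ℂ} (hφ : Continuous φ) {C : ℝ}
    (hC : ∀ z, ‖φ z‖ ≤ C * wt z ^ 3) : Integrable φ hypMeasure := by
  rw [hypMeasure_eq, integrable_withDensity_iff_integrable_smul' measurable_hypDensity
    (Eventually.of_forall fun _ => ENNReal.ofReal_lt_top)]
  refine Integrable.of_bound (C := C) ?_ (Eventually.of_forall fun z => ?_)
  · exact (measurable_hypDensity.ennreal_toReal.smul hφ.measurable).aestronglyMeasurable
  · have h0 := wt_pos z
    rw [norm_smul, ENNReal.toReal_ofReal (by positivity), Real.norm_of_nonneg (by positivity),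
      inv_mul_le_iff₀ (by positivity), mul_comm]
    exact hC z

lemma wt_smul_pow_mul (g : SU21) (k : ℕ) (z : Ball2) :
    ((wt (g • z) ^ (3 * k) : ℝ) : ℂ) =
      ((wt z ^ (3 * k) : ℝ) : ℂ) * jacobian g z ^ k * starRingEnd ℂ (jacobian g z ^ k) := by
  rw [pow_mul, wt_smul_pow_three, mul_pow, ← pow_mul, map_pow, mul_assoc, ← mul_pow,
    Complex.mul_conj, Complex.normSq_eq_norm_sq]
  push_cast
  rfl

/-- Jacobians at the center have modulus at most 1, so all but two factors may be dropped. The bound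
is then independent of `k`. -/
lemma norm_jacobian_conj_pow_le (g h : SU21) {k : ℕ} (hk : 2 ≤ k) :
    ‖jacobian (g⁻¹ * h * g) origin ^ k‖ ≤ 64 * ‖jacobian h (g • origin)‖ ^ 2 := by
  have h3 := norm_jacobian_conj_le (o := origin) rfl g h
  have h4 := norm_jacobian_zero_le_one (o := origin) rfl (g⁻¹ * h * g)
  rw [norm_pow]
  calc ‖jacobian (g⁻¹ * h * g) origin‖ ^ k ≤ ‖jacobian (g⁻¹ * h * g) origin‖ ^ 2 :=
        pow_le_pow_of_le_one (norm_nonneg _) h4 hk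
    _ ≤ (8 * ‖jacobian h (g • origin)‖) ^ 2 := pow_le_pow_left₀ (norm_nonneg _) h3 2
    _ = _ := by ring

variable {Γ : Subgroup SU21} {k : ℕ} {F : Set Ball2}

lemma continuous_kernel (g : SU21) {h : Ball2 → ℂ} (hh : h ∈ H0 Γ k) :
    Continuous fun w : Ball2 => ((wt w ^ (3 * k) : ℝ) : ℂ) * jacobian g w ^ k *
      starRingEnd ℂ (h w) :=
  ((Complex.continuous_ofReal.comp (continuous_wt.pow _)).mul
    ((continuous_jacobian g).pow k)).mul (Complex.continuous_conj.comp (continuous_of_mem hh))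

lemma kernel_smul (g : SU21) {h : Ball2 → ℂ} (hh : h ∈ H0 Γ k) (γ : Γ) (z : Ball2) :
    ((wt (γ • z) ^ (3 * k) : ℝ) : ℂ) * jacobian g⁻¹ (γ • z) ^ k * starRingEnd ℂ (h (γ • z)) =
      ((wt z ^ (3 * k) : ℝ) : ℂ) * jacobian (g⁻¹ * γ) z ^ k * starRingEnd ℂ (h z) := by
  rw [show γ • z = (γ : SU21) • z from rfl, wt_smul_pow_mul, jacobian_mul,
    ← hh.2 γ.1 γ.2 z, map_mul, mul_pow]
  ring

lemma bergmanKernel_self {d : ℕ} (ω : Fin d → H0 Γ k) (z : Ball2) :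
    bergmanKernel ω z z = ((∑ j, ‖(ω j : Ball2 → ℂ) z‖ ^ 2 : ℝ) : ℂ) := by
  rw [bergmanKernel, Complex.ofReal_sum]
  refine Finset.sum_congr rfl fun j _ => ?_
  rw [Complex.mul_conj, Complex.normSq_eq_norm_sq]

lemma bergmanNorm_eq {d : ℕ} (ω : Fin d → H0 Γ k) (z : Ball2) :
    bergmanNorm ω z = wt z ^ (3 * k) * ∑ j, ‖(ω j : Ball2 → ℂ) z‖ ^ 2 := by
  rw [bergmanNorm, bergmanKernel_self, Complex.norm_real,
    Real.norm_of_nonneg (Finset.sum_nonneg fun j _ => sq_nonneg _)]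
  rfl

variable [CompactSpace (PicardSurface Γ)]

lemma integrable_kernel (hk : 2 ≤ k) (g : SU21) {h : Ball2 → ℂ} (hh : h ∈ H0 Γ k) :
    Integrable (fun w : Ball2 => ((wt w ^ (3 * k) : ℝ) : ℂ) * jacobian g⁻¹ w ^ k *
      starRingEnd ℂ (h w)) hypMeasure := by
  obtain ⟨M, hM⟩ := exists_normSq_le hh
  set C := 8 * ‖mat g 2 2‖ ^ 3
  refine integrable_hypMeasure_of_norm_le (continuous_kernel _ hh) (C := C ^ k * (M + 1))
    fun z => ?_
  have h0 := wt_pos z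
  have h1 := pow_mul_norm_le hk (hM z)
  rw [norm_mul, norm_mul, RCLike.norm_conj, Complex.norm_real,
    Real.norm_of_nonneg (by positivity), norm_pow, pow_sub_mul_pow hk]
  calc wt z ^ 3 * wt z ^ (3 * k - 3) * ‖jacobian g⁻¹ z‖ ^ k * ‖h z‖
      = wt z ^ 3 * (‖jacobian g⁻¹ z‖ ^ k * (wt z ^ (3 * k - 3) * ‖h z‖)) := by ring
    _ ≤ wt z ^ 3 * (C ^ k * (M + 1)) := by
        gcongr
        exact norm_jacobian_inv_le g z
    _ = _ := by ring

/-- Substituting `w = g • u` turns the integrand into the conjugate of the weight times the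
pull-back of `h` by `g`, to which the mean value property at the center applies. -/
lemma integral_kernel (hk : 2 ≤ k) (g : SU21) {h : Ball2 → ℂ} (hh : h ∈ H0 Γ k) :
    ∫ w : Ball2, ((wt w ^ (3 * k) : ℝ) : ℂ) * jacobian g⁻¹ w ^ k * starRingEnd ℂ (h w)
      ∂hypMeasure = starRingEnd ℂ (h (g • origin) * jacobian g origin ^ k) *
        weightIntegral k := by
  obtain ⟨M, hM⟩ := exists_normSq_le hh
  have h1 := integral_pow_mul hk (isHolomorphic_slash hh.1 g k) (M := M)
    fun z => by rw [normSq_slash]; exact hM _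
  rw [← integral_smul_eq_self (μ := hypMeasure) (fun w : Ball2 => ((wt w ^ (3 * k) : ℝ) : ℂ) *
    jacobian g⁻¹ w ^ k * starRingEnd ℂ (h w)) (g := g)]
  have h2 := congrArg (starRingEnd ℂ) h1
  rw [← integral_conj, map_mul, Complex.conj_ofReal] at h2
  rw [← h2]
  refine integral_congr_ae (Eventually.of_forall fun u => ?_)
  have h3 : jacobian g⁻¹ (g • u) * jacobian g u = 1 := by
    rw [← jacobian_mul, inv_mul_cancel, jacobian_one]
  simp only [wt_smul_pow_mul, map_mul, Complex.conj_ofReal]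
  have h4 : jacobian g⁻¹ (g • u) ^ k * jacobian g u ^ k = 1 := by
    rw [← mul_pow, h3, one_pow]
  linear_combination (((wt u ^ (3 * k) : ℝ) : ℂ) * starRingEnd ℂ (jacobian g u ^ k) *
    starRingEnd ℂ (h (g • u))) * h4

variable [DiscreteTopology Γ]

/-- The inner product of a section with a Poincaré series, by unfolding. -/
lemma innerHyp_poincareSeries (hF : IsFundamentalDomain Γ F hypMeasure) (hk : 2 ≤ k) (g : SU21)
    {h : Ball2 → ℂ} (hh : h ∈ H0 Γ k) :
    innerHyp F k (poincareSeries Γ g k) h =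
      starRingEnd ℂ (h (g • origin) * jacobian g origin ^ k) * weightIntegral k := by
  rw [← integral_kernel hk g hh]
  set φ : Ball2 → ℂ := fun w => ((wt w ^ (3 * k) : ℝ) : ℂ) * jacobian g⁻¹ w ^ k *
    starRingEnd ℂ (h w) with hφ
  have hint : Integrable φ hypMeasure := integrable_kernel hk g hh
  have hinti : ∀ γ : Γ, Integrable (fun z => φ (γ • z)) (hypMeasure.restrict F) := fun γ =>
    ((measurePreserving_smul γ hypMeasure).integrable_comp_of_integrable hint).restrict
  have hfin : ∑' γ : Γ, ∫⁻ z in F, ‖φ (γ • z)‖ₑ ∂hypMeasure ≠ ⊤ := by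
    rw [← hF.lintegral_eq_tsum'' fun z => ‖φ z‖ₑ]
    exact hint.2.ne
  have hsum : Summable fun γ : Γ => ∫ z in F, ‖φ (γ • z)‖ ∂hypMeasure := by
    refine (ENNReal.summable_toReal hfin).congr fun γ => ?_
    rw [integral_norm_eq_lintegral_enorm (hinti γ).aestronglyMeasurable]
  have h1 := hasSum_integral_of_summable_integral_norm hinti hsum
  rw [hF.integral_eq_tsum'' φ hint, h1.tsum_eq, innerHyp]
  refine integral_congr_ae (Eventually.of_forall fun z => ?_)
  simp only [hφ, kernel_smul g hh]
  rw [tsum_mul_right, tsum_mul_left]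
  rfl

lemma eq_sum_innerHyp (hF : IsFundamentalDomain Γ F hypMeasure) {d : ℕ} {ω : Fin d → H0 Γ k}
    (hω : IsOrthonormalBasis Γ F k ω) (f : H0 Γ k) :
    f = ∑ j, innerHyp F k f (ω j) • ω j := by
  have hf : f ∈ Submodule.span ℂ (Set.range ω) := hω.2 ▸ Submodule.mem_top
  obtain ⟨c, hc⟩ := (Submodule.mem_span_range_iff_exists_fun ℂ).1 hf
  have h1 : ∀ j, innerHyp F k f (ω j) = c j := fun j => by
    rw [← hc, innerHyp_sum_left hF]
    simp [hω.1]
  simp only [h1, hc]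

/-- The Bergman kernel on the diagonal as a Poincaré series. -/
lemma bergmanNorm_mul_weightIntegral (hF : IsFundamentalDomain Γ F hypMeasure) (hk : 2 ≤ k)
    {d : ℕ} {ω : Fin d → H0 Γ k} (hω : IsOrthonormalBasis Γ F k ω) (g : SU21) :
    ((bergmanNorm ω (g • origin) * weightIntegral k : ℝ) : ℂ) =
      ∑' γ : Γ, jacobian (g⁻¹ * γ * g) origin ^ k := by
  -- The coefficients of the Poincaré series are the conjugates of `ω_j(z) j(g,0)^k`, times the
  -- weight integral. Evaluating at `z = g • 0` and multiplying by `j(g,0)^k` produces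
  -- `|j(g,0)|^{2k} ∑ |ω_j(z)|²`, and `|j(g,0)|^{2k} = wt(z)^{3k}`.
  have h1 := eq_sum_innerHyp hF hω ⟨poincareSeries Γ g k, poincareSeries_mem Γ g hk⟩
  have h2 := congrFun (congrArg Subtype.val h1) (g • origin)
  simp only [innerHyp_poincareSeries hF hk g (ω _).2, Submodule.coe_sum, Submodule.coe_smul,
    Finset.sum_apply, Pi.smul_apply, smul_eq_mul] at h2
  have h3 : ∑' γ : Γ, jacobian (g⁻¹ * γ * g) origin ^ k =
      poincareSeries Γ g k (g • origin) * jacobian g origin ^ k := by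
    rw [poincareSeries, ← tsum_mul_right]
    refine tsum_congr fun γ => ?_
    rw [jacobian_mul, mul_pow]
  have h4 := wt_smul_pow_mul g k origin
  rw [show wt origin = 1 by simp [wt, origin], one_pow, Complex.ofReal_one, one_mul] at h4
  rw [h3, h2, bergmanNorm_eq, Complex.ofReal_mul, Complex.ofReal_mul, h4, Complex.ofReal_sum,
    Finset.mul_sum, Finset.sum_mul, Finset.sum_mul]
  refine Finset.sum_congr rfl fun j _ => ?_
  rw [← Complex.normSq_eq_norm_sq, ← Complex.mul_conj, map_mul]
  ring

/-- The norm of the Bergman kernel, normalized by the weight integral, is bounded independently of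
the weight, locally on the ball. -/
lemma exists_bergmanNorm_mul_le (hF : IsFundamentalDomain Γ F hypMeasure) (z : Ball2) :
    ∃ r > 0, ∃ M : ℝ, Metric.ball z.1 r ⊆ Metric.ball 0 1 ∧
      ∀ (k : ℕ), 2 ≤ k → ∀ (d : ℕ) (ω : Fin d → H0 Γ k), IsOrthonormalBasis Γ F k ω →
        ∀ x : Ball2, x.1 ∈ Metric.ball z.1 r → bergmanNorm ω x * weightIntegral k ≤ M := by
  obtain ⟨r, hr, u, hu, hu0, hball, hle⟩ := exists_summable_norm_jacobian_sq_le Γ z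
  refine ⟨r, hr, ∑' γ, 64 * u γ, hball, fun k hk d ω hω x hx => ?_⟩
  obtain ⟨g, rfl⟩ := exists_smul_eq_of_zero x
  have h1 := bergmanNorm_mul_weightIntegral hF hk hω g
  change (g • origin).1 ∈ _ at hx
  have h2 : ∀ γ : Γ, ‖jacobian (g⁻¹ * γ * g) origin ^ k‖ ≤ 64 * u γ := fun γ =>
    (norm_jacobian_conj_pow_le g γ hk).trans (mul_le_mul_of_nonneg_left (hle γ _ hx) (by norm_num))
  have h5 := tsum_of_norm_bounded (hu.mul_left 64).hasSum h2
  rw [← h1, Complex.norm_real] at h5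
  exact (le_abs_self _).trans h5

/-- The norm of the Bergman kernel, normalized by the weight integral, tends to `1`. -/
lemma eventually_half_le_bergmanNorm_mul (hF : IsFundamentalDomain Γ F hypMeasure)
    (htf : ∀ γ ∈ Γ, IsOfFinOrder γ → γ = 1) {d : ℕ → ℕ} {ω : (k : ℕ) → Fin (d k) → H0 Γ k}
    (hω : ∀ k, 1 ≤ k → IsOrthonormalBasis Γ F k (ω k)) (z : Ball2) :
    ∀ᶠ k in atTop, 1 / 2 ≤ bergmanNorm (ω k) z * weightIntegral k := by
  classical
  obtain ⟨g, hg⟩ := exists_smul_eq_of_zero z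
  change g • origin = z at hg
  subst hg
  obtain ⟨r, hr, u, hu, hu0, hball, hle⟩ := exists_summable_norm_jacobian_sq_le Γ (g • origin)
  have h2 : ∀ k, 2 ≤ k → ∀ γ : Γ, ‖jacobian (g⁻¹ * γ * g) origin ^ k‖ ≤ 64 * u γ := fun k hk γ =>
    (norm_jacobian_conj_pow_le g γ hk).trans (mul_le_mul_of_nonneg_left
      (hle γ _ (Metric.mem_ball_self hr)) (by norm_num))
  -- Dominated convergence: a term with `γ ≠ 1` has modulus below 1 before taking the power, because
  -- `γ` moves `g • origin`.
  have hlim : Tendsto (fun k : ℕ => ∑' γ : Γ, jacobian (g⁻¹ * γ * g) origin ^ k) atTop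
      (𝓝 (∑' γ : Γ, if γ = 1 then 1 else 0)) := by
    refine tendsto_tsum_of_dominated_convergence (hu.mul_left 64) (fun γ => ?_)
      ((eventually_ge_atTop 2).mono fun k hk => h2 k hk)
    split_ifs with hγ
    · subst hγ
      simp [jacobian_one]
    · refine tendsto_pow_atTop_nhds_zero_of_norm_lt_one
        (norm_jacobian_zero_lt_one (o := origin) rfl fun h => ?_)
      refine smul_ne_of_torsionFree Γ htf hγ (g • origin) ?_
      rw [mul_smul, mul_smul, inv_smul_eq_iff] at h
      exact h
  rw [tsum_ite_eq] at hlim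
  have hre := (Complex.continuous_re.tendsto _).comp hlim
  filter_upwards [hre.eventually (lt_mem_nhds (show (1 / 2 : ℝ) < (1 : ℂ).re by norm_num)),
    eventually_ge_atTop 2] with k hk hk2
  rw [Function.comp_apply, ← bergmanNorm_mul_weightIntegral hF hk2 (hω k (by omega)) g,
    Complex.ofReal_re] at hk
  exact hk.le

end Reproducing

/-! ### Calculus of Wirtinger derivatives. -/

section Wirtinger

variable {φ ψ : E → ℂ} {z : E}

lemma dZ_congr (j : Fin 2) (h : φ =ᶠ[𝓝 z] ψ) : dZ j φ z = dZ j ψ z := by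
  rw [dZ, dZ, h.fderiv_eq]

lemma dZbar_congr (j : Fin 2) (h : φ =ᶠ[𝓝 z] ψ) : dZbar j φ z = dZbar j ψ z := by
  rw [dZbar, dZbar, h.fderiv_eq]

lemma dZbar_eventuallyEq (j : Fin 2) (h : φ =ᶠ[𝓝 z] ψ) : dZbar j φ =ᶠ[𝓝 z] dZbar j ψ :=
  h.eventuallyEq_nhds.mono fun _ hw => dZbar_congr j hw

lemma dZ_add (j : Fin 2) (hφ : DifferentiableAt ℝ φ z) (hψ : DifferentiableAt ℝ ψ z) :
    dZ j (fun w => φ w + ψ w) z = dZ j φ z + dZ j ψ z := by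
  simp only [dZ, fderiv_fun_add hφ hψ, _root_.add_apply]
  ring

lemma dZbar_add (j : Fin 2) (hφ : DifferentiableAt ℝ φ z) (hψ : DifferentiableAt ℝ ψ z) :
    dZbar j (fun w => φ w + ψ w) z = dZbar j φ z + dZbar j ψ z := by
  simp only [dZbar, fderiv_fun_add hφ hψ, _root_.add_apply]
  ring

lemma dZ_const_mul (j : Fin 2) (c : ℂ) (hφ : DifferentiableAt ℝ φ z) :
    dZ j (fun w => c * φ w) z = c * dZ j φ z := by
  simp only [dZ, fderiv_const_mul hφ, _root_.smul_apply, smul_eq_mul]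
  ring

lemma dZbar_const_mul (j : Fin 2) (c : ℂ) (hφ : DifferentiableAt ℝ φ z) :
    dZbar j (fun w => c * φ w) z = c * dZbar j φ z := by
  simp only [dZbar, fderiv_const_mul hφ, _root_.smul_apply, smul_eq_mul]
  ring

lemma dZ_mul (j : Fin 2) (hφ : DifferentiableAt ℝ φ z) (hψ : DifferentiableAt ℝ ψ z) :
    dZ j (fun w => φ w * ψ w) z = φ z * dZ j ψ z + ψ z * dZ j φ z := by
  simp only [dZ, fderiv_fun_mul hφ hψ, _root_.add_apply, _root_.smul_apply, smul_eq_mul]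
  ring

lemma dZbar_mul (j : Fin 2) (hφ : DifferentiableAt ℝ φ z) (hψ : DifferentiableAt ℝ ψ z) :
    dZbar j (fun w => φ w * ψ w) z = φ z * dZbar j ψ z + ψ z * dZbar j φ z := by
  simp only [dZbar, fderiv_fun_mul hφ hψ, _root_.add_apply, _root_.smul_apply, smul_eq_mul]
  ring

lemma dZ_sum {ι : Type*} (s : Finset ι) (j : Fin 2) {φ : ι → E → ℂ}
    (hφ : ∀ i ∈ s, DifferentiableAt ℝ (φ i) z) :
    dZ j (fun w => ∑ i ∈ s, φ i w) z = ∑ i ∈ s, dZ j (φ i) z := by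
  simp only [dZ, fderiv_fun_sum hφ, _root_.sum_apply, Finset.mul_sum, ← Finset.sum_sub_distrib]

lemma dZbar_sum {ι : Type*} (s : Finset ι) (j : Fin 2) {φ : ι → E → ℂ}
    (hφ : ∀ i ∈ s, DifferentiableAt ℝ (φ i) z) :
    dZbar j (fun w => ∑ i ∈ s, φ i w) z = ∑ i ∈ s, dZbar j (φ i) z := by
  simp only [dZbar, fderiv_fun_sum hφ, _root_.sum_apply, Finset.mul_sum, ← Finset.sum_add_distrib]

lemma fderiv_real_apply (hφ : DifferentiableAt ℂ φ z) (v : E) :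
    fderiv ℝ φ z v = fderiv ℂ φ z v := by
  rw [(hφ.hasFDerivAt.restrictScalars ℝ).fderiv]
  rfl

lemma dZ_of_holomorphic (j : Fin 2) (hφ : DifferentiableAt ℂ φ z) :
    dZ j φ z = fderiv ℂ φ z (e j) := by
  rw [dZ, fderiv_real_apply hφ, fderiv_real_apply hφ, map_smul, smul_eq_mul, ← mul_assoc,
    Complex.I_mul_I]
  ring

lemma dZbar_of_holomorphic (j : Fin 2) (hφ : DifferentiableAt ℂ φ z) : dZbar j φ z = 0 := by
  rw [dZbar, fderiv_real_apply hφ, fderiv_real_apply hφ, map_smul, smul_eq_mul, ← mul_assoc,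
    Complex.I_mul_I]
  ring

lemma fderiv_conj_apply (hφ : DifferentiableAt ℝ φ z) (v : E) :
    fderiv ℝ (fun w => starRingEnd ℂ (φ w)) z v = starRingEnd ℂ (fderiv ℝ φ z v) := by
  have h := (Complex.conjCLE : ℂ →L[ℝ] ℂ).hasFDerivAt.comp z hφ.hasFDerivAt
  exact congrArg (fun L : E →L[ℝ] ℂ => L v) h.fderiv

lemma differentiableAt_conj (hφ : DifferentiableAt ℝ φ z) :
    DifferentiableAt ℝ (fun w => starRingEnd ℂ (φ w)) z :=
  ((Complex.conjCLE : ℂ →L[ℝ] ℂ).hasFDerivAt.comp z hφ.hasFDerivAt).differentiableAt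

lemma dZ_conj (j : Fin 2) (hφ : DifferentiableAt ℝ φ z) :
    dZ j (fun w => starRingEnd ℂ (φ w)) z = starRingEnd ℂ (dZbar j φ z) := by
  rw [dZ, dZbar, fderiv_conj_apply hφ, fderiv_conj_apply hφ]
  simp only [map_mul, map_add, Complex.conj_I, map_div₀, map_one, Complex.conj_ofNat]
  ring

lemma dZbar_conj (j : Fin 2) (hφ : DifferentiableAt ℝ φ z) :
    dZbar j (fun w => starRingEnd ℂ (φ w)) z = starRingEnd ℂ (dZ j φ z) := by
  rw [dZ, dZbar, fderiv_conj_apply hφ, fderiv_conj_apply hφ]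
  simp only [map_mul, map_sub, Complex.conj_I, map_div₀, map_one, Complex.conj_ofNat]
  ring

variable {p : E → ℝ}

lemma differentiableAt_ofReal (hp : DifferentiableAt ℝ p z) :
    DifferentiableAt ℝ (fun w => (p w : ℂ)) z :=
  (Complex.ofRealCLM.hasFDerivAt.comp z hp.hasFDerivAt).differentiableAt

lemma fderiv_ofReal_apply (hp : DifferentiableAt ℝ p z) (v : E) :
    fderiv ℝ (fun w => (p w : ℂ)) z v = (fderiv ℝ p z v : ℂ) := by
  have h := Complex.ofRealCLM.hasFDerivAt.comp z hp.hasFDerivAt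
  exact congrArg (fun L : E →L[ℝ] ℂ => L v) h.fderiv

lemma dZbar_log (l : Fin 2) (hp : DifferentiableAt ℝ p z) (h0 : p z ≠ 0) :
    dZbar l (fun w => (Real.log (p w) : ℂ)) z =
      ((p z : ℂ))⁻¹ * dZbar l (fun w => (p w : ℂ)) z := by
  have hlog := hp.hasFDerivAt.log h0
  simp only [dZbar, fderiv_ofReal_apply hlog.differentiableAt, fderiv_ofReal_apply hp,
    hlog.fderiv, _root_.smul_apply, smul_eq_mul, Complex.ofReal_mul,
    Complex.ofReal_inv]
  ring

lemma dZ_inv (j : Fin 2) (hφ : DifferentiableAt ℝ φ z) (h0 : φ z ≠ 0) :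
    dZ j (fun w => (φ w)⁻¹) z = -dZ j φ z / φ z ^ 2 := by
  have hd : DifferentiableAt ℝ (fun w => (φ w)⁻¹) z := hφ.fun_inv h0
  have h1 := dZ_mul j hφ hd
  have h2 : dZ j (fun w => φ w * (φ w)⁻¹) z = 0 := by
    rw [dZ_congr (ψ := fun _ => 1) j ((hφ.continuousAt.eventually_ne h0).mono fun w hw =>
      mul_inv_cancel₀ hw)]
    simp [dZ]
  rw [h2] at h1
  field_simp at h1 ⊢
  linear_combination -h1

/-- The mixed second derivatives of the logarithm of a positive function. -/
lemma dZ_dZbar_log (j l : Fin 2) (hp : ∀ᶠ w in 𝓝 z, DifferentiableAt ℝ p w) (h0 : p z ≠ 0)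
    (hbar : DifferentiableAt ℝ (dZbar l fun w => (p w : ℂ)) z) :
    DifferentiableAt ℝ (dZbar l fun w => (Real.log (p w) : ℂ)) z ∧
    dZ j (dZbar l fun w => (Real.log (p w) : ℂ)) z =
      (p z : ℂ)⁻¹ * dZ j (dZbar l fun w => (p w : ℂ)) z -
        dZbar l (fun w => (p w : ℂ)) z * dZ j (fun w => (p w : ℂ)) z / (p z : ℂ) ^ 2 := by
  have hpz := hp.self_of_nhds
  have h0' : (p z : ℂ) ≠ 0 := Complex.ofReal_ne_zero.2 h0
  have hinv : DifferentiableAt ℝ (fun w => (p w : ℂ)⁻¹) z :=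
    (differentiableAt_ofReal hpz).fun_inv h0'
  have heq : dZbar l (fun w => (Real.log (p w) : ℂ)) =ᶠ[𝓝 z]
      fun w => (p w : ℂ)⁻¹ * dZbar l (fun w => (p w : ℂ)) w := by
    filter_upwards [hp, hpz.continuousAt.eventually_ne h0] with w hw hw0
    exact dZbar_log l hw hw0
  refine ⟨(hinv.mul hbar).congr_of_eventuallyEq heq, ?_⟩
  rw [dZ_congr j heq, dZ_mul j hinv hbar, dZ_inv j (differentiableAt_ofReal hpz) h0']
  ring

end Wirtinger

/-! ### Mixed derivatives of the logarithm of a sum of squared moduli. -/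

section SumOfSquares

variable {ι : Type*} [Fintype ι] {f : ι → E → ℂ} {U : Set E} {z : E}

lemma ofReal_sum_norm_sq (f : ι → E → ℂ) :
    (fun w => ((∑ i, ‖f i w‖ ^ 2 : ℝ) : ℂ)) = fun w => ∑ i, f i w * starRingEnd ℂ (f i w) := by
  ext w
  rw [Complex.ofReal_sum]
  refine Finset.sum_congr rfl fun i _ => ?_
  rw [Complex.mul_conj, Complex.normSq_eq_norm_sq]

lemma differentiableAt_norm_sq {φ : E → ℂ} (hφ : DifferentiableAt ℝ φ z) :
    DifferentiableAt ℝ (fun w => ‖φ w‖ ^ 2) z :=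
  hφ.norm_sq ℝ

lemma norm_sum_mul_conj_sq_le (a b : ι → ℂ) :
    ‖∑ i, a i * starRingEnd ℂ (b i)‖ ^ 2 ≤ (∑ i, ‖a i‖ ^ 2) * ∑ i, ‖b i‖ ^ 2 := by
  refine le_trans ?_ (Finset.sum_mul_sq_le_sq_mul_sq _ _ _)
  refine pow_le_pow_left₀ (norm_nonneg _) ((norm_sum_le _ _).trans_eq ?_) 2
  simp only [norm_mul, RCLike.norm_conj]

lemma dZ_sum_norm_sq (hU : IsOpen U) (hf : ∀ i, DifferentiableOn ℂ (f i) U) (hz : z ∈ U)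
    (j : Fin 2) : dZ j (fun w => ((∑ i, ‖f i w‖ ^ 2 : ℝ) : ℂ)) z =
      ∑ i, fderiv ℂ (f i) z (e j) * starRingEnd ℂ (f i z) := by
  have hC : ∀ i, DifferentiableAt ℂ (f i) z := fun i => (hf i).differentiableAt (hU.mem_nhds hz)
  have hR : ∀ i, DifferentiableAt ℝ (f i) z := fun i => (hC i).restrictScalars ℝ
  rw [ofReal_sum_norm_sq, dZ_sum _ _ fun i _ => (hR i).fun_mul (differentiableAt_conj (hR i))]
  refine Finset.sum_congr rfl fun i _ => ?_
  rw [dZ_mul j (hR i) (differentiableAt_conj (hR i)), dZ_conj j (hR i),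
    dZbar_of_holomorphic j (hC i), dZ_of_holomorphic j (hC i), map_zero]
  ring

lemma dZbar_sum_norm_sq (hU : IsOpen U) (hf : ∀ i, DifferentiableOn ℂ (f i) U) (hz : z ∈ U)
    (l : Fin 2) : dZbar l (fun w => ((∑ i, ‖f i w‖ ^ 2 : ℝ) : ℂ)) z =
      ∑ i, f i z * starRingEnd ℂ (fderiv ℂ (f i) z (e l)) := by
  have hC : ∀ i, DifferentiableAt ℂ (f i) z := fun i => (hf i).differentiableAt (hU.mem_nhds hz)
  have hR : ∀ i, DifferentiableAt ℝ (f i) z := fun i => (hC i).restrictScalars ℝ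
  rw [ofReal_sum_norm_sq, dZbar_sum _ _ fun i _ => (hR i).fun_mul (differentiableAt_conj (hR i))]
  refine Finset.sum_congr rfl fun i _ => ?_
  rw [dZbar_mul l (hR i) (differentiableAt_conj (hR i)), dZbar_conj l (hR i),
    dZbar_of_holomorphic l (hC i), dZ_of_holomorphic l (hC i)]
  ring

lemma dZ_dZbar_sum_norm_sq (hU : IsOpen U) (hf : ∀ i, DifferentiableOn ℂ (f i) U) (hz : z ∈ U)
    (j l : Fin 2) : DifferentiableAt ℝ (dZbar l fun w => ((∑ i, ‖f i w‖ ^ 2 : ℝ) : ℂ)) z ∧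
      dZ j (dZbar l fun w => ((∑ i, ‖f i w‖ ^ 2 : ℝ) : ℂ)) z =
      ∑ i, fderiv ℂ (f i) z (e j) * starRingEnd ℂ (fderiv ℂ (f i) z (e l)) := by
  have hC : ∀ i, DifferentiableAt ℂ (f i) z := fun i => (hf i).differentiableAt (hU.mem_nhds hz)
  have hR : ∀ i, DifferentiableAt ℝ (f i) z := fun i => (hC i).restrictScalars ℝ
  have hC' : ∀ i, DifferentiableAt ℂ (fun w => fderiv ℂ (f i) w (e l)) z := fun i =>
    (differentiableOn_fderiv_apply hU (hf i) (e l)).differentiableAt (hU.mem_nhds hz)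
  have hR' : ∀ i, DifferentiableAt ℝ (fun w => fderiv ℂ (f i) w (e l)) z := fun i =>
    (hC' i).restrictScalars ℝ
  have heq : (dZbar l fun w => ((∑ i, ‖f i w‖ ^ 2 : ℝ) : ℂ)) =ᶠ[𝓝 z]
      fun w => ∑ i, f i w * starRingEnd ℂ (fderiv ℂ (f i) w (e l)) := by
    filter_upwards [hU.mem_nhds hz] with w hw
    exact dZbar_sum_norm_sq hU hf hw l
  have hd : ∀ i ∈ Finset.univ, DifferentiableAt ℝ
      (fun w => f i w * starRingEnd ℂ (fderiv ℂ (f i) w (e l))) z := fun i _ =>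
    (hR i).fun_mul (differentiableAt_conj (hR' i))
  refine ⟨(DifferentiableAt.fun_sum hd).congr_of_eventuallyEq heq, ?_⟩
  rw [dZ_congr j heq, dZ_sum _ _ hd]
  refine Finset.sum_congr rfl fun i _ => ?_
  rw [dZ_mul j (hR i) (differentiableAt_conj (hR' i)), dZ_conj j (hR' i),
    dZbar_of_holomorphic j (hC' i), dZ_of_holomorphic j (hC i), map_zero]
  ring

/-- With `p = ∑ |f_i|²`, Cauchy–Schwarz bounds each of the two terms of `∂∂̄ log p = p⁻¹ ∂∂̄p - ∂p
∂̄p / p²` by `K`. -/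
lemma norm_dZ_dZbar_log_sum_le (hU : IsOpen U) (hf : ∀ i, DifferentiableOn ℂ (f i) U)
    (hz : z ∈ U) {K : ℝ} (h0 : 0 < ∑ i, ‖f i z‖ ^ 2)
    (hK : ∀ j, ∑ i, ‖fderiv ℂ (f i) z (e j)‖ ^ 2 ≤ K * ∑ i, ‖f i z‖ ^ 2) (j l : Fin 2) :
    DifferentiableAt ℝ (dZbar l fun w => (Real.log (∑ i, ‖f i w‖ ^ 2) : ℂ)) z ∧
    ‖dZ j (dZbar l fun w => (Real.log (∑ i, ‖f i w‖ ^ 2) : ℂ)) z‖ ≤ 2 * K := by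
  set A := ∑ i, ‖f i z‖ ^ 2 with hA
  have hp : ∀ᶠ w in 𝓝 z, DifferentiableAt ℝ (fun w => ∑ i, ‖f i w‖ ^ 2) w := by
    filter_upwards [hU.mem_nhds hz] with w hw
    exact DifferentiableAt.fun_sum fun i _ => differentiableAt_norm_sq
      (((hf i).differentiableAt (hU.mem_nhds hw)).restrictScalars ℝ)
  have h2 := dZ_dZbar_sum_norm_sq hU hf hz j l
  have h3 := dZ_dZbar_log j l hp h0.ne' h2.1
  refine ⟨h3.1, ?_⟩
  rw [h3.2, h2.2, dZ_sum_norm_sq hU hf hz, dZbar_sum_norm_sq hU hf hz, ← hA]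
  set D : Fin 2 → ℝ := fun j => ∑ i, ‖fderiv ℂ (f i) z (e j)‖ ^ 2 with hD
  have hD0 : ∀ j, 0 ≤ D j := fun j => Finset.sum_nonneg fun i _ => sq_nonneg _
  have hK0 : 0 ≤ K := by
    by_contra hneg
    nlinarith [hK 0, hD0 0]
  have b1 : ‖∑ i, fderiv ℂ (f i) z (e j) * starRingEnd ℂ (fderiv ℂ (f i) z (e l))‖ ≤ K * A := by
    refine (abs_le_of_sq_le_sq' ((norm_sum_mul_conj_sq_le _ _).trans ?_) (by positivity)).2
    rw [sq]
    exact mul_le_mul (hK j) (hK l) (hD0 l) (by positivity)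
  have b2 : ‖∑ i, f i z * starRingEnd ℂ (fderiv ℂ (f i) z (e l))‖ *
      ‖∑ i, fderiv ℂ (f i) z (e j) * starRingEnd ℂ (f i z)‖ ≤ K * A ^ 2 := by
    refine (abs_le_of_sq_le_sq' ?_ (by positivity)).2
    rw [mul_pow]
    calc _ ≤ (A * D l) * (D j * A) := mul_le_mul (norm_sum_mul_conj_sq_le _ _)
          (norm_sum_mul_conj_sq_le _ _) (sq_nonneg _) (mul_nonneg h0.le (hD0 l))
      _ ≤ (A * (K * A)) * ((K * A) * A) := by
          gcongr
          · exact hK l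
          · exact hK j
      _ = _ := by ring
  refine (norm_sub_le _ _).trans ?_
  rw [norm_mul, norm_div, norm_mul, norm_inv, norm_pow, Complex.norm_real,
    Real.norm_of_nonneg h0.le]
  have c1 : A⁻¹ * ‖∑ i, fderiv ℂ (f i) z (e j) * starRingEnd ℂ (fderiv ℂ (f i) z (e l))‖ ≤ K := by
    rw [inv_mul_le_iff₀ h0]
    linarith
  have c2 : ‖∑ i, f i z * starRingEnd ℂ (fderiv ℂ (f i) z (e l))‖ *
      ‖∑ i, fderiv ℂ (f i) z (e j) * starRingEnd ℂ (f i z)‖ / A ^ 2 ≤ K := by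
    rw [div_le_iff₀ (by positivity)]
    exact b2
  linarith

/-- The Cauchy estimate for a finite family of holomorphic functions. -/
lemma sum_norm_fderiv_sq_le {r C : ℝ} (hr : 0 < r) (v : E)
    (hf : ∀ i, ∀ t : ℂ, ‖t‖ ≤ r → DifferentiableAt ℂ (f i) (z + t • v))
    (hC : ∀ t : ℂ, ‖t‖ ≤ r → ∑ i, ‖f i (z + t • v)‖ ^ 2 ≤ C) :
    ∑ i, ‖fderiv ℂ (f i) z v‖ ^ 2 ≤ C / r ^ 2 := by
  have hC0 : 0 ≤ C := (Finset.sum_nonneg fun i _ => sq_nonneg _).trans (hC 0 (by simpa using hr.le))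
  -- Treating the family as one vector-valued map gives a single Cauchy estimate for the whole sum,
  -- with no factor depending on the number of functions.
  let G : E → EuclideanSpace ℂ ι := fun w => WithLp.toLp 2 fun i => f i w
  have hG : ∀ t : ℂ, ‖t‖ ≤ r → DifferentiableAt ℂ G (z + t • v) := fun t ht =>
    differentiableAt_euclidean.2 fun i => hf i t ht
  have hGn : ∀ w, ‖G w‖ ^ 2 = ∑ i, ‖f i w‖ ^ 2 := fun w => EuclideanSpace.norm_sq_eq _
  have h1 := norm_fderiv_apply_le (C := Real.sqrt C) hr hG fun t ht =>
    Real.le_sqrt_of_sq_le (by rw [hGn]; exact hC t ht)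
  have hGz : DifferentiableAt ℂ G z := by simpa using hG 0 (by simpa using hr.le)
  have h2 : ∀ i, fderiv ℂ (f i) z v = fderiv ℂ G z v i := fun i => by
    have := ((EuclideanSpace.proj i : EuclideanSpace ℂ ι →L[ℂ] ℂ).hasFDerivAt.comp z
      hGz.hasFDerivAt).fderiv
    exact congrArg (fun L : E →L[ℂ] ℂ => L v) this
  simp only [h2]
  rw [← EuclideanSpace.norm_sq_eq]
  calc ‖fderiv ℂ G z v‖ ^ 2 ≤ (Real.sqrt C / r) ^ 2 := pow_le_pow_left₀ (norm_nonneg _) h1 2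
    _ = _ := by rw [div_pow, Real.sq_sqrt hC0]

end SumOfSquares

/-! ### From coefficient bounds to the volume ratio. -/

section VolumeForm

variable {Γ : Subgroup SU21} {k d : ℕ}

lemma norm_frame_apply_le (a : Fin 4) (j : Fin 2) : ‖frame a j‖ ≤ 1 := by
  fin_cases a <;> fin_cases j <;> simp [frame, e]

/-- The constant is four pairs of indices times 2 for each alternating term; the prefactor `1/(2π)`
is bounded by 1. -/
lemma norm_bergmanMetric_le {ω : Fin d → H0 Γ k} {z : Ball2} {T : ℝ}
    (hT : ∀ j l, ‖dZ j (dZbar l (extendZero fun x => (Real.log (bergmanNorm ω x) : ℂ))) z.1‖ ≤ T)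
    (a b : Fin 4) : ‖bergmanMetric ω z (frame a) (frame b)‖ ≤ 8 * T := by
  have hT0 : 0 ≤ T := (norm_nonneg _).trans (hT 0 0)
  have h1 : ‖-(Complex.I / (2 * Real.pi))‖ ≤ 1 := by
    rw [norm_neg, norm_div, Complex.norm_I, norm_mul, Complex.norm_real,
      Real.norm_of_nonneg Real.pi_pos.le, RCLike.norm_ofNat]
    rw [div_le_one (by positivity)]
    nlinarith [Real.pi_gt_three]
  have h2 : ∀ j l : Fin 2, ‖frame a j * starRingEnd ℂ (frame b l) -
      frame b j * starRingEnd ℂ (frame a l)‖ ≤ 2 := fun j l => by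
    refine (norm_sub_le _ _).trans ?_
    rw [norm_mul, norm_mul, RCLike.norm_conj, RCLike.norm_conj]
    have := mul_le_one₀ (norm_frame_apply_le a j) (norm_nonneg _) (norm_frame_apply_le b l)
    have := mul_le_one₀ (norm_frame_apply_le b j) (norm_nonneg _) (norm_frame_apply_le a l)
    linarith
  rw [bergmanMetric, norm_mul]
  refine (mul_le_of_le_one_left (norm_nonneg _) h1).trans ?_
  rw [ddbar]
  calc _ ≤ ∑ j : Fin 2, ∑ l : Fin 2, T * 2 := by
        refine norm_sum_le_of_le _ fun j _ => norm_sum_le_of_le _ fun l _ => ?_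
        rw [norm_mul]
        exact mul_le_mul (hT j l) (h2 j l) (norm_nonneg _) hT0
    _ = _ := by
        simp only [Finset.sum_const, Finset.card_univ, Fintype.card_fin, nsmul_eq_mul]
        push_cast
        ring

/-- The constant is `3 · 8²`, from the three products in `halfWedgeSq`. The hyperbolic volume
depends on `z` only, so it is kept as part of the constant. -/
lemma norm_volRatio_le {ω : Fin d → H0 Γ k} {z : Ball2} {T : ℝ}
    (hT : ∀ j l, ‖dZ j (dZbar l (extendZero fun x => (Real.log (bergmanNorm ω x) : ℂ))) z.1‖ ≤ T) :
    ‖volRatio ω z‖ ≤ 192 * T ^ 2 / ‖hypVol z frame‖ := by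
  have hT0 : 0 ≤ T := (norm_nonneg _).trans (hT 0 0)
  have h := norm_bergmanMetric_le hT
  rw [volRatio, norm_div, bergmanVol, halfWedgeSq]
  gcongr
  have h2 : ∀ a b c d, ‖bergmanMetric ω z (frame a) (frame b) *
      bergmanMetric ω z (frame c) (frame d)‖ ≤ 64 * T ^ 2 := fun a b c d => by
    rw [norm_mul]
    calc _ ≤ 8 * T * (8 * T) := mul_le_mul (h a b) (h c d) (norm_nonneg _) (by positivity)
      _ = _ := by ring
  refine (norm_add_le _ _).trans ?_
  have h3 := norm_sub_le (bergmanMetric ω z (frame 0) (frame 1) *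
    bergmanMetric ω z (frame 2) (frame 3)) (bergmanMetric ω z (frame 0) (frame 2) *
    bergmanMetric ω z (frame 1) (frame 3))
  linarith [h2 0 1 2 3, h2 0 2 1 3, h2 0 3 1 2]

end VolumeForm

/-! ### Growth in `k` of the Bergman metric at a fixed point. -/

section Estimate

/-- The Kähler potential of the hyperbolic metric. -/
def logWeight (x : E) : ℂ := (Real.log (1 - ‖x‖ ^ 2) : ℂ)

lemma contDiffAt_logWeight (z : Ball2) : ContDiffAt ℝ 2 logWeight z.1 := by
  have h1 : ContDiffAt ℝ 2 (fun x : E => 1 - ‖x‖ ^ 2) z.1 :=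
    contDiffAt_const.sub (contDiff_norm_sq ℝ).contDiffAt
  exact Complex.ofRealCLM.contDiff.contDiffAt.comp z.1 (h1.log (wt_pos z).ne')

lemma differentiableAt_dZbar {φ : E → ℂ} {z : E} (hφ : ContDiffAt ℝ 2 φ z) (l : Fin 2) :
    DifferentiableAt ℝ (dZbar l φ) z := by
  have h1 : DifferentiableAt ℝ (fderiv ℝ φ) z :=
    (hφ.fderiv_right (m := 1) (by norm_num)).differentiableAt (by norm_num)
  have h2 : ∀ v : E, DifferentiableAt ℝ (fun w => fderiv ℝ φ w v) z := fun v =>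
    h1.clm_apply (differentiableAt_const v)
  exact ((h2 (e l)).add ((h2 (Complex.I • e l)).const_mul _)).const_mul _

variable {Γ : Subgroup SU21} {k d : ℕ}

/-- The potential of the Bergman metric splits into a multiple of the potential of the hyperbolic
metric and the logarithm of the Bergman kernel in the standard frame. -/
lemma extendZero_log_bergmanNorm_eventuallyEq (ω : Fin d → H0 Γ k) {z : Ball2}
    (h0 : 0 < ∑ i, ‖extendZero (ω i) z.1‖ ^ 2) :
    (extendZero fun x => (Real.log (bergmanNorm ω x) : ℂ)) =ᶠ[𝓝 z.1] fun w =>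
      ((3 * k : ℕ) : ℂ) * logWeight w +
        (Real.log (∑ i, ‖extendZero (ω i) w‖ ^ 2) : ℂ) := by
  have hcont : ContinuousAt (fun w => ∑ i, ‖extendZero (ω i) w‖ ^ 2) z.1 :=
    tendsto_finsetSum _ fun i _ => ((((ω i).2.1).differentiableAt
      (Metric.isOpen_ball.mem_nhds z.2)).continuousAt.norm.pow 2)
  filter_upwards [Metric.isOpen_ball.mem_nhds z.2, hcont.eventually (lt_mem_nhds h0)] with w hw hw0
  have hw' : ∀ i, extendZero (ω i) w = (ω i : Ball2 → ℂ) ⟨w, hw⟩ := fun i =>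
    extendZero_apply _ hw
  simp only [hw'] at hw0 ⊢
  rw [extendZero_apply _ hw, bergmanNorm_eq,
    Real.log_mul (pow_pos (wt_pos ⟨w, hw⟩) _).ne' hw0.ne', Real.log_pow]
  simp only [logWeight, wt]
  push_cast
  rfl

lemma norm_dZ_dZbar_log_bergmanNorm_le (ω : Fin d → H0 Γ k) {z : Ball2} {K : ℝ}
    (h0 : 0 < ∑ i, ‖extendZero (ω i) z.1‖ ^ 2)
    (hK : ∀ j, ∑ i, ‖fderiv ℂ (extendZero (ω i)) z.1 (e j)‖ ^ 2 ≤
      K * ∑ i, ‖extendZero (ω i) z.1‖ ^ 2) (j l : Fin 2) :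
    ‖dZ j (dZbar l (extendZero fun x => (Real.log (bergmanNorm ω x) : ℂ))) z.1‖ ≤
      3 * k * ‖dZ j (dZbar l logWeight) z.1‖ + 2 * K := by
  have hU : IsOpen (Metric.ball (0 : E) 1) := Metric.isOpen_ball
  have hf : ∀ i, DifferentiableOn ℂ (extendZero (ω i)) (Metric.ball 0 1) := fun i => (ω i).2.1
  have hA := norm_dZ_dZbar_log_sum_le hU hf z.2 h0 hK j l
  have hW := contDiffAt_logWeight z
  have hWd := differentiableAt_dZbar hW l
  have hcont : ContinuousAt (fun w => ∑ i, ‖extendZero (ω i) w‖ ^ 2) z.1 :=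
    tendsto_finsetSum _ fun i _ => (((hf i).differentiableAt
      (hU.mem_nhds z.2)).continuousAt.norm.pow 2)
  have heq : dZbar l (extendZero fun x => (Real.log (bergmanNorm ω x) : ℂ)) =ᶠ[𝓝 z.1] fun w =>
      ((3 * k : ℕ) : ℂ) * dZbar l logWeight w +
        dZbar l (fun w => (Real.log (∑ i, ‖extendZero (ω i) w‖ ^ 2) : ℂ)) w := by
    refine (dZbar_eventuallyEq l (extendZero_log_bergmanNorm_eventuallyEq ω h0)).trans ?_
    filter_upwards [hU.mem_nhds z.2, hcont.eventually (lt_mem_nhds h0)] with w hw hw0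
    have hWw : DifferentiableAt ℝ logWeight w :=
      (contDiffAt_logWeight ⟨w, hw⟩).differentiableAt (by norm_num)
    have hp : DifferentiableAt ℝ (fun w => ∑ i, ‖extendZero (ω i) w‖ ^ 2) w :=
      DifferentiableAt.fun_sum fun i _ => differentiableAt_norm_sq
        (((hf i).differentiableAt (hU.mem_nhds hw)).restrictScalars ℝ)
    rw [dZbar_add l (hWw.const_mul _)
      (differentiableAt_ofReal (hp.hasFDerivAt.log hw0.ne').differentiableAt),
      dZbar_const_mul l _ hWw]
  rw [dZ_congr j heq, dZ_add j (hWd.const_mul _) hA.1, dZ_const_mul j _ hWd]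
  refine (norm_add_le _ _).trans (add_le_add ?_ hA.2)
  rw [norm_mul, Complex.norm_natCast]
  push_cast
  exact le_rfl

/-- A displacement by `ε = wt z/(18k)` lowers the weight by at most `3ε`, a relative loss of
`1/(6k)`. Bernoulli's inequality with exponent `3k` then leaves at least one half. -/
lemma half_pow_le_wt_pow (hk : 1 ≤ k) {z x : Ball2}
    (hx : ‖x.1 - z.1‖ ≤ wt z / (18 * k)) : wt z ^ (3 * k) / 2 ≤ wt x ^ (3 * k) := by
  have hk' : (1 : ℝ) ≤ k := by exact_mod_cast hk
  have hz0 := wt_pos z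
  have hz1 := wt_le_one z
  set ε := wt z / (18 * k) with hε
  have hεk : 18 * k * ε = wt z := by rw [hε]; field_simp
  have hε0 : 0 < ε := by positivity
  have hε1 : ε ≤ 1 := by nlinarith
  have hzn := (mem_ball_zero_iff.1 z.2).le
  have h1 : ‖x.1‖ ≤ ‖z.1‖ + ε := by linarith [norm_sub_norm_le x.1 z.1]
  have h2 : wt z - 3 * ε ≤ wt x := by
    rw [wt, wt]
    nlinarith [norm_nonneg x.1, norm_nonneg z.1]
  have h3 : wt z * (1 + -(1 / (6 * k))) = wt z - 3 * ε := by
    rw [hε]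
    field_simp
    ring
  have h6 : 1 / (6 * (k : ℝ)) ≤ 1 := by
    rw [div_le_one (by positivity)]
    linarith
  have h4 := one_add_mul_le_pow (a := -(1 / (6 * (k : ℝ)))) (by linarith) (3 * k)
  have h5 : (1 : ℝ) + ((3 * k : ℕ) : ℝ) * -(1 / (6 * (k : ℝ))) = 1 / 2 := by
    push_cast
    field_simp
    ring
  rw [h5] at h4
  calc wt z ^ (3 * k) / 2 = wt z ^ (3 * k) * (1 / 2) := by ring
    _ ≤ wt z ^ (3 * k) * (1 + -(1 / (6 * (k : ℝ)))) ^ (3 * k) := by gcongr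
    _ = (wt z - 3 * ε) ^ (3 * k) := by rw [← mul_pow, h3]
    _ ≤ wt x ^ (3 * k) := by
        refine pow_le_pow_left₀ ?_ h2 _
        rw [← h3]
        exact mul_nonneg hz0.le (by linarith)

variable [DiscreteTopology Γ] [CompactSpace (PicardSurface Γ)] {F : Set Ball2}

/-- The first derivatives of an orthonormal basis grow at most linearly in the weight, relative to
the Bergman kernel. -/
lemma exists_sum_norm_fderiv_sq_le (hF : IsFundamentalDomain Γ F hypMeasure) (z : Ball2) :
    ∃ C : ℝ, ∀ (k : ℕ), 2 ≤ k → ∀ (d : ℕ) (ω : Fin d → H0 Γ k), IsOrthonormalBasis Γ F k ω →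
      1 / 2 ≤ bergmanNorm ω z * weightIntegral k → ∀ j : Fin 2,
        ∑ i, ‖fderiv ℂ (extendZero (ω i)) z.1 (e j)‖ ^ 2 ≤
          C * (k : ℝ) ^ 2 * ∑ i, ‖extendZero (ω i) z.1‖ ^ 2 := by
  obtain ⟨r, hr, M, hball, hM⟩ := exists_bergmanNorm_mul_le hF z
  have hz0 := wt_pos z
  -- Discs of radius `η / k` stay in the region of the uniform upper bound and satisfy the
  -- hypothesis of `half_pow_le_wt_pow`.
  set η := min (wt z / 18) (r / 2) with hη
  have hη0 : 0 < η := by positivity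
  refine ⟨4 * M / η ^ 2, fun k hk d ω hω hlow j => ?_⟩
  have hk' : (2 : ℝ) ≤ k := by exact_mod_cast hk
  have hV := weightIntegral_pos k
  set B : E → ℝ := fun w => ∑ i, ‖extendZero (ω i) w‖ ^ 2 with hB
  have hBx : ∀ x : Ball2, bergmanNorm ω x = wt x ^ (3 * k) * B x.1 := fun x => by
    simp only [bergmanNorm_eq, hB, extendZero_apply _ x.2]
  have hB0 : ∀ w, 0 ≤ B w := fun w => Finset.sum_nonneg fun i _ => sq_nonneg _
  have hM0 : 0 ≤ M := by
    have := hM k hk d ω hω z (Metric.mem_ball_self hr)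
    linarith
  have hej : ‖e j‖ = 1 := by simp [e]
  have hmem : ∀ t : ℂ, ‖t‖ ≤ η / k → ‖z.1 + t • e j - z.1‖ ≤ η / k := fun t ht => by
    rwa [add_sub_cancel_left, norm_smul, hej, mul_one]
  have hηk : η / k < r := by
    have h1 : η / k ≤ η := div_le_self hη0.le (by linarith)
    linarith [min_le_right (wt z / 18) (r / 2)]
  have hin : ∀ t : ℂ, ‖t‖ ≤ η / k → z.1 + t • e j ∈ Metric.ball z.1 r := fun t ht =>
    mem_ball_iff_norm.2 ((hmem t ht).trans_lt hηk)
  -- The upper bound near `z` is divided by the lower bound at `z`, so that the weight integral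
  -- cancels. One factor 2 comes from the lower bound and one from the variation of the weight.
  have hsup : ∀ t : ℂ, ‖t‖ ≤ η / k → B (z.1 + t • e j) ≤ 4 * M * B z.1 := by
    intro t ht
    let x : Ball2 := ⟨z.1 + t • e j, hball (hin t ht)⟩
    have h1 := hM k hk d ω hω x (hin t ht)
    have h2 : wt z ^ (3 * k) / 2 ≤ wt x ^ (3 * k) := by
      refine half_pow_le_wt_pow (by omega) ((hmem t ht).trans ?_)
      rw [← div_div]
      exact div_le_div_of_nonneg_right (min_le_left _ _) (by linarith)
    rw [hBx] at h1 hlow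
    have h3 : wt z ^ (3 * k) / 2 * B x.1 * weightIntegral k ≤ M :=
      (mul_le_mul_of_nonneg_right (mul_le_mul_of_nonneg_right h2 (hB0 _)) hV.le).trans h1
    have h4 : M ≤ 2 * M * (wt z ^ (3 * k) * B z.1 * weightIntegral k) := by nlinarith
    have hpos : 0 < wt z ^ (3 * k) * weightIntegral k := by positivity
    refine le_of_mul_le_mul_left (a := wt z ^ (3 * k) * weightIntegral k) ?_ hpos
    change wt z ^ (3 * k) * weightIntegral k * B x.1 ≤ _
    nlinarith
  have hd : ∀ i, ∀ t : ℂ, ‖t‖ ≤ η / k →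
      DifferentiableAt ℂ (extendZero (ω i)) (z.1 + t • e j) := fun i t ht =>
    ((ω i).2.1).differentiableAt (Metric.isOpen_ball.mem_nhds (hball (hin t ht)))
  refine (sum_norm_fderiv_sq_le (by positivity) (e j) hd hsup).trans_eq ?_
  rw [div_pow]
  field_simp
  rfl

/-- The ratio of the Bergman volume form to the hyperbolic volume form is `O(k⁴)`. -/
lemma exists_norm_volRatio_le (hF : IsFundamentalDomain Γ F hypMeasure) (z : Ball2) :
    ∃ C : ℝ, ∀ (k : ℕ), 2 ≤ k → ∀ (d : ℕ) (ω : Fin d → H0 Γ k), IsOrthonormalBasis Γ F k ω →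
      1 / 2 ≤ bergmanNorm ω z * weightIntegral k → ‖volRatio ω z‖ ≤ C * (k : ℝ) ^ 4 := by
  obtain ⟨C, hC⟩ := exists_sum_norm_fderiv_sq_le hF z
  set A := ∑ j, ∑ l, ‖dZ j (dZbar l logWeight) z.1‖ with hA
  refine ⟨192 * (3 * A + 2 * C) ^ 2 / ‖hypVol z frame‖, fun k hk d ω hω hlow => ?_⟩
  have hk' : (2 : ℝ) ≤ k := by exact_mod_cast hk
  have h0 : 0 < ∑ i, ‖extendZero (ω i) z.1‖ ^ 2 := by
    rw [bergmanNorm_eq] at hlow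
    simp only [extendZero_apply _ z.2]
    by_contra hneg
    have h1 : ∑ i, ‖(ω i : Ball2 → ℂ) z‖ ^ 2 = 0 :=
      le_antisymm (not_lt.1 hneg) (Finset.sum_nonneg fun i _ => sq_nonneg _)
    rw [h1] at hlow
    norm_num at hlow
  have hT : ∀ j l, ‖dZ j (dZbar l (extendZero fun x => (Real.log (bergmanNorm ω x) : ℂ))) z.1‖ ≤
      (3 * A + 2 * C) * (k : ℝ) ^ 2 := fun j l => by
    refine (norm_dZ_dZbar_log_bergmanNorm_le ω h0 (hC k hk d ω hω hlow) j l).trans ?_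
    have hA1 : ‖dZ j (dZbar l logWeight) z.1‖ ≤ A := by
      refine le_trans ?_ (Finset.single_le_sum (f := fun j => ∑ l,
        ‖dZ j (dZbar l logWeight) z.1‖) (fun j _ => Finset.sum_nonneg fun l _ => norm_nonneg _)
        (Finset.mem_univ j))
      exact Finset.single_le_sum (f := fun l => ‖dZ j (dZbar l logWeight) z.1‖)
        (fun l _ => norm_nonneg _) (Finset.mem_univ l)
    have hA0 : 0 ≤ A := (norm_nonneg _).trans hA1
    have hkk : (k : ℝ) ≤ (k : ℝ) ^ 2 := by nlinarith
    calc 3 * (k : ℝ) * ‖dZ j (dZbar l logWeight) z.1‖ + 2 * (C * (k : ℝ) ^ 2)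
        ≤ 3 * (k : ℝ) ^ 2 * A + 2 * (C * (k : ℝ) ^ 2) := by gcongr
      _ = _ := by ring
  refine (norm_volRatio_le hT).trans_eq ?_
  ring

end Estimate

end Picard

end

/-! ### Conclusion: the limit is zero. -/

theorem corollary11 (Γ : Subgroup Picard.SU21)
    (hdiscrete : DiscreteTopology Γ)
    (htorsionfree : ∀ γ ∈ Γ, IsOfFinOrder γ → γ = 1)
    (hcocompact : CompactSpace (Picard.PicardSurface Γ))
    (F : Set Picard.Ball2)
    (hF : IsFundamentalDomain Γ F Picard.hypMeasure) :
    (∀ k : ℕ, 1 ≤ k → ∃ (d : ℕ) (ω : Fin d → Picard.H0 Γ k),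
      Picard.IsOrthonormalBasis Γ F k ω) ∧
    ∀ (d : ℕ → ℕ) (ω : (k : ℕ) → Fin (d k) → Picard.H0 Γ k),
      (∀ k : ℕ, 1 ≤ k → Picard.IsOrthonormalBasis Γ F k (ω k)) →
      ∀ z ∈ F,
        (∀ᶠ k : ℕ in atTop, Picard.bergmanKernel (ω k) z z ≠ 0) ∧
        ∃ L : ℝ, Tendsto
            (fun k : ℕ => 1 / ((k : ℝ) ^ 4 * Real.log k) * ‖Picard.volRatio (ω k) z‖)
            atTop (𝓝 L) ∧
          L ≤ 6048 := by
  refine ⟨fun k _ => Picard.exists_isOrthonormalBasis hF k, fun d ω hω z _ => ?_⟩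
  have hlow := Picard.eventually_half_le_bergmanNorm_mul hF htorsionfree hω z
  refine ⟨hlow.mono fun k hk h => ?_, 0, ?_, by norm_num⟩
  · rw [Picard.bergmanNorm, h, norm_zero, mul_zero, zero_mul] at hk
    norm_num at hk
  · obtain ⟨C, hC⟩ := Picard.exists_norm_volRatio_le hF z
    -- The factor `k⁴` cancels against the growth bound, leaving a multiple of `1 / log k`.
    have hlim : Tendsto (fun k : ℕ => C * (Real.log k)⁻¹) atTop (𝓝 0) := by
      have h := (Real.tendsto_log_atTop.comp tendsto_natCast_atTop_atTop).inv_tendsto_atTop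
      simpa using h.const_mul C
    refine squeeze_zero' ?_ ?_ hlim
    · filter_upwards with k
      have := Real.log_natCast_nonneg k
      positivity
    · filter_upwards [hlow, eventually_ge_atTop 2] with k hk hk2
      have hk' : (2 : ℝ) ≤ k := by exact_mod_cast hk2
      have hlog : 0 < Real.log k := Real.log_pos (by linarith)
      have h := hC k hk2 _ (ω k) (hω k (by omega)) hk
      calc 1 / ((k : ℝ) ^ 4 * Real.log k) * ‖Picard.volRatio (ω k) z‖
          ≤ 1 / ((k : ℝ) ^ 4 * Real.log k) * (C * (k : ℝ) ^ 4) := by gcongr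
        _ = C * (Real.log k)⁻¹ := by field_simp
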